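/- Let $N,n\ge 1$, $p\ge 0$ be integers, $A\in\mathbb R^{n\times n}$, $C\in\mathbb R^{p\times n}$ and $\sigma,\gamma^\star\in\mathbb R$. A *design* is a pair $(\Gamma,\mathcal K)$ of a digraph $\Gamma$ on $\{1,\dots,N\}$ in which every node has a self-loop, and a real $N\times N$ block matrix $\mathcal K=(K_{ij})$ with $K_{ij}\in\mathbb R^{n\times p}$. Let $G=(g_{ij})$ be the adjacency matrix of $\Gamma$ ($g_{ij}=1$ if $(i,j)$ is an edge, $0$ otherwise), $D=\mathrm{diag}(D_{11},\dots,D_{NN})$ with $D_{ii}=\sum_j g_{ji}$ the in-degree matrix, $\mathcal K*G^\top$ the block matrix with $(i,j)$ block $g_{ji}K_{ij}$, and $$\mathcal A=I_N\otimes A-(\mathcal K*G^\top)(I_N\otimes C),\qquad \mathcal B=\mathcal K*G^\top,\qquad \mathcal C=(D^{-1}\otimes I_n)(G^\top\otimes I_n),$$ so that $\dot e=\mathcal A e+\mathcal B m$, $\bar e=\mathcal C e$ is the estimation error system of the $N$ interconnected observers, with noise $m$. Let $\mathcal C_i$ be the $i$-th block of $n$ rows of $\mathcal C$, so that $\bar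 e_i=\mathcal C_i e$. Throughout, let either $\mathcal X=\mathcal C$ (global case) or $\mathcal X=\mathcal C_i$ for a fixed $i\in\{1,\dots,N\}$ (local case), and let $T(s)=\mathcal X(sI-\mathcal A)^{-1}\mathcal B$ be the transfer function from $m$ to $\mathcal X e$. The error system is *stable* if all eigenvalues of $\mathcal A$ have negative real part. Its *rate of convergence* is then $|\max\{\mathrm{Re}\,\lambda:\lambda\in\mathrm{eig}(\mathcal A)\}|$, and $\|T\|_\infty=\sup_{\omega\in\mathbb R}\|T(j\omega)\|$ with the induced $2$-norm. Say that $(\Gamma,\mathcal K)$ *meets the specifications* if the error system is stable with rate of convergence $>\sigma$ and $\|T\|_\infty<\gamma^\star$, and *meets the non-strict specifications* if it is stable with rate of convergence $\ge\sigma$ and $\|T\|_\infty\le\gamma^\star$. A design is *edge-minimal* for one of the two kinds of specifications if it meets them and no design that meets them has a digraph with fewer edges (self-loops count as edges). Write $\mathrm{He}(M,P)=M^\top P+P^\top M$. Consider the optimization problem in the variables $\mathcal K$, $G$ (a $0$-$1$ matrix with unit diagonal), $P_S$, $P_H$: $$\inf\ \mathrm{tr}(D)\quad\text{s.t.}\quad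 \mathrm{He}(\mathcal A,P_S)+2\sigma P_S<0,\quad \begin{bmatrix}\mathrm{He}(\mathcal A,P_H)&P_H\mathcal B&\mathcal X^\top\\ \mathcal B^\top P_H&-\gamma^\star I&0\\ \mathcal X&0&-\gamma^\star I\end{bmatrix}<0,\quad P_S=P_S^\top>0,\ P_H=P_H^\top>0.\qquad(\ast)$$ **Theorem.** In the global case, and in the local case for every $i$: 1. A pair $(\Gamma,\mathcal K)$ is a design that meets the specifications if and only if there are $P_S,P_H$ such that $(\mathcal K,G,P_S,P_H)$ satisfies the constraints of $(\ast)$, where $G$ is the adjacency matrix of $\Gamma$. 2. $(\Gamma,\mathcal K)$ is edge-minimal for the specifications if and only if there are $P_S,P_H$ such that $(\mathcal K,G,P_S,P_H)$ is a solution (minimizer) of $(\ast)$. In particular an edge-minimal design exists if and only if $(\ast)$ has a solution; and the least number of edges of a digraph that meets the specifications for some gain equals the value of $(\ast)$ (both are $+\infty$ if there is no such digraph). 3. $(\Gamma,\mathcal K)$ is a design that meets the non-strict specifications if and only if for all $\sigma'<\sigma$ and $\gamma'>\gamma^\star$ there are $P_S,P_H$ satisfying, with $(\mathcal K,G)$,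 the constraints of $(\ast)$ with $(\sigma',\gamma')$ in place of $(\sigma,\gamma^\star)$; and $(\Gamma,\mathcal K)$ is edge-minimal for the non-strict specifications if and only if $(\mathcal K,G)$ minimizes $\mathrm{tr}(D)$ subject to this last constraint. -/

import Mathlib

open scoped Matrix Kronecker

noncomputable section

namespace InterconnectedObservers

/-! ### Linear systems `ė = M e + B m`, `z = X e` -/

section LinearSystems

variable {ι ν κ : Type*} [Fintype ι] [DecidableEq ι] [Fintype ν] [DecidableEq ν]
  [Fintype κ] [DecidableEq κ]

/-- The set `eig(M)` of (complex) eigenvalues of a real square matrix. -/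
def eig (M : Matrix ι ι ℝ) : Set ℂ := spectrum ℂ (M.map Complex.ofReal)

/-- The spectral abscissa `α(M) = max {Re λ : λ ∈ eig(M)}`
(the set is finite, and nonempty as soon as `ι` is). -/
def spectralAbscissa (M : Matrix ι ι ℝ) : ℝ := sSup (Complex.re '' eig M)

/-- All eigenvalues have negative real part. -/
def IsHurwitz (M : Matrix ι ι ℝ) : Prop := ∀ l ∈ eig M, l.re < 0

/-- The rate of convergence of a stable system `ė = M e`: the absolute value of the real part
of the dominant eigenvalue. It is only used together with `IsHurwitz M`. -/
def convergenceRate (M : Matrix ι ι ℝ) : ℝ := |spectralAbscissa M|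

/-- The transfer function `T(s) = X (s I - M)⁻¹ B` from `m` to `z`. -/
def transferFunction (M : Matrix ι ι ℝ) (B : Matrix ι ν ℝ) (X : Matrix κ ι ℝ) (s : ℂ) :
    Matrix κ ν ℂ :=
  X.map Complex.ofReal * (s • (1 : Matrix ι ι ℂ) - M.map Complex.ofReal)⁻¹ *
    B.map Complex.ofReal

open scoped Matrix.Norms.L2Operator in
/-- `‖T‖_∞ = sup_{ω ∈ ℝ} ‖T(jω)‖`, where `‖·‖` is the induced 2-norm (the operator norm
between Euclidean spaces). The supremum is taken in the extended reals. -/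
def hInfNorm (T : ℂ → Matrix κ ν ℂ) : EReal := ⨆ ω : ℝ, ((‖T (Complex.I * ω)‖ : ℝ) : EReal)

/-- `He(A, B) = Aᵀ B + Bᵀ A`. -/
def He (A B : Matrix ι ι ℝ) : Matrix ι ι ℝ := Aᵀ * B + Bᵀ * A

/-- `M = Mᵀ < 0`. -/
def IsNegDef (M : Matrix ι ι ℝ) : Prop := (-M).PosDef

/-- The symmetric `3 × 3` block matrix
`[He(M,P), P B, Xᵀ; Bᵀ P, -γ I, 0; X, 0, -γ I]` (for symmetric `P`). -/
def boundedRealMatrix (M : Matrix ι ι ℝ) (B : Matrix ι ν ℝ) (X : Matrix κ ι ℝ) (γ : ℝ)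
    (P : Matrix ι ι ℝ) : Matrix ((ι ⊕ ν) ⊕ κ) ((ι ⊕ ν) ⊕ κ) ℝ :=
  Matrix.fromBlocks
    (Matrix.fromBlocks (He M P) (P * B) (Bᵀ * P) (-(γ • (1 : Matrix ν ν ℝ))))
    (Matrix.fromRows Xᵀ 0)
    (Matrix.fromCols X 0)
    (-(γ • (1 : Matrix κ κ ℝ)))

end LinearSystems

/-! ### Digraphs and the error system of interconnected observers -/

section Observers

variable {N n p : ℕ}

/-- Adjacency matrix: `g_ij = 1` if `(i, j)` is an edge, and `0` otherwise. -/
def adjacency (Γ : Digraph (Fin N)) : Matrix (Fin N) (Fin N) ℝ :=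
  open Classical in Matrix.of fun i j => if Γ.Adj i j then 1 else 0

/-- The number of edges of a digraph (self-loops are edges). -/
def numEdges (Γ : Digraph (Fin N)) : ℕ := {e : Fin N × Fin N | Γ.Adj e.1 e.2}.ncard

/-- Every node carries a self-loop. -/
def IsSelfConnected (Γ : Digraph (Fin N)) : Prop := ∀ i, Γ.Adj i i

/-- `G` is a `0`-`1` matrix with unit diagonal, that is, a legitimate value of the matrix
variable `G`: the adjacency matrix of a digraph all of whose nodes are self-connected. -/
def IsAdjacencyMatrix (G : Matrix (Fin N) (Fin N) ℝ) : Prop :=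
  (∀ i j, G i j = 0 ∨ G i j = 1) ∧ ∀ i, G i i = 1

/-- The in-degree matrix `D`, with `D_ii = ∑_j g_ji`. -/
def inDegreeMatrix (G : Matrix (Fin N) (Fin N) ℝ) : Matrix (Fin N) (Fin N) ℝ :=
  Matrix.diagonal fun i => ∑ j, G j i

/-- The block gain matrix `𝒦`: the `n × p` block `K_ij` has entries `𝒦 (i, a) (j, b)`. -/
abbrev GainMatrix (N n p : ℕ) : Type := Matrix (Fin N × Fin n) (Fin N × Fin p) ℝ

/-- The Khatri-Rao product `𝒦 * H`, with `𝒦` partitioned in `n × p` blocks and `H` in scalars: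
its `(i, j)` block is `H_ij K_ij`. -/
def khatriRao (K : GainMatrix N n p) (H : Matrix (Fin N) (Fin N) ℝ) : GainMatrix N n p :=
  Matrix.of fun r c => K r c * H r.1 c.1

/-- `ℬ = 𝒦 * Gᵀ`. -/
def matB (K : GainMatrix N n p) (G : Matrix (Fin N) (Fin N) ℝ) : GainMatrix N n p :=
  khatriRao K Gᵀ

/-- `𝒜 = I_N ⊗ A - (𝒦 * Gᵀ)(I_N ⊗ C)`. -/
def matA (A : Matrix (Fin n) (Fin n) ℝ) (C : Matrix (Fin p) (Fin n) ℝ)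
    (K : GainMatrix N n p) (G : Matrix (Fin N) (Fin N) ℝ) :
    Matrix (Fin N × Fin n) (Fin N × Fin n) ℝ :=
  (1 : Matrix (Fin N) (Fin N) ℝ) ⊗ₖ A
    - khatriRao K Gᵀ * ((1 : Matrix (Fin N) (Fin N) ℝ) ⊗ₖ C)

/-- `𝒞 = (D⁻¹ ⊗ I_n)(Gᵀ ⊗ I_n)`: the output `ē = 𝒞 e` is the global estimation error. -/
def matC (n : ℕ) (G : Matrix (Fin N) (Fin N) ℝ) :
    Matrix (Fin N × Fin n) (Fin N × Fin n) ℝ :=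
  ((inDegreeMatrix G)⁻¹ ⊗ₖ (1 : Matrix (Fin n) (Fin n) ℝ))
    * (Gᵀ ⊗ₖ (1 : Matrix (Fin n) (Fin n) ℝ))

/-- `𝒞_i`, the `i`-th block of `n` rows of `𝒞`: the output `ē_i = 𝒞_i e` is the local
estimation error of agent `i`. -/
def matCLocal (n : ℕ) (i : Fin N) (G : Matrix (Fin N) (Fin N) ℝ) :
    Matrix (Fin n) (Fin N × Fin n) ℝ :=
  (matC n G).submatrix (fun a => (i, a)) id

/-- An output matrix `𝒳` as a function of `G`. -/
abbrev OutputMatrix (N n : ℕ) (κ : Type) : Type :=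
  Matrix (Fin N) (Fin N) ℝ → Matrix κ (Fin N × Fin n) ℝ

variable {κ : Type} [Fintype κ] [DecidableEq κ]

/-- The transfer function `𝒳 (s I - 𝒜)⁻¹ ℬ` from the noise `m` to `𝒳 e`. -/
def errorTransfer (A : Matrix (Fin n) (Fin n) ℝ) (C : Matrix (Fin p) (Fin n) ℝ)
    (X : OutputMatrix N n κ) (K : GainMatrix N n p) (G : Matrix (Fin N) (Fin N) ℝ) :
    ℂ → Matrix κ (Fin N × Fin p) ℂ :=
  transferFunction (matA A C K G) (matB K G) (X G)

/-- The digraph `Γ` (with self-loops) and the gain `𝒦` give a stable error system with rate of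
convergence larger than `σ` and `H_∞` norm from `m` to `𝒳 e` less than `γ`. -/
def MeetsSpecs (A : Matrix (Fin n) (Fin n) ℝ) (C : Matrix (Fin p) (Fin n) ℝ)
    (σ γ : ℝ) (X : OutputMatrix N n κ) (Γ : Digraph (Fin N)) (K : GainMatrix N n p) : Prop :=
  IsSelfConnected Γ ∧ IsHurwitz (matA A C K (adjacency Γ)) ∧
    σ < convergenceRate (matA A C K (adjacency Γ)) ∧
    hInfNorm (errorTransfer A C X K (adjacency Γ)) < (γ : EReal)

/-- The same with non-strict bounds: rate of convergence at least `σ`, `H_∞` norm at most `γ`. -/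
def MeetsSpecsNonstrict (A : Matrix (Fin n) (Fin n) ℝ) (C : Matrix (Fin p) (Fin n) ℝ)
    (σ γ : ℝ) (X : OutputMatrix N n κ) (Γ : Digraph (Fin N)) (K : GainMatrix N n p) : Prop :=
  IsSelfConnected Γ ∧ IsHurwitz (matA A C K (adjacency Γ)) ∧
    σ ≤ convergenceRate (matA A C K (adjacency Γ)) ∧
    hInfNorm (errorTransfer A C X K (adjacency Γ)) ≤ (γ : EReal)

/-- `(Γ, 𝒦)` satisfies the specification `S`, and no digraph that satisfies `S` with some gain
has fewer edges than `Γ`. -/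
def IsEdgeMinimal (S : Digraph (Fin N) → GainMatrix N n p → Prop)
    (Γ : Digraph (Fin N)) (K : GainMatrix N n p) : Prop :=
  S Γ K ∧ ∀ Γ' K', S Γ' K' → numEdges Γ ≤ numEdges Γ'

/-- The constraints of the optimization problem in the variables `(𝒦, G, P_S, P_H)`:
`P_S = P_Sᵀ > 0`, `P_H = P_Hᵀ > 0`, `He(𝒜, P_S) + 2 σ P_S < 0` and the bounded-real matrix
inequality with bound `γ`. -/
def Feasible (A : Matrix (Fin n) (Fin n) ℝ) (C : Matrix (Fin p) (Fin n) ℝ)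
    (σ γ : ℝ) (X : OutputMatrix N n κ) (K : GainMatrix N n p) (G : Matrix (Fin N) (Fin N) ℝ)
    (PS PH : Matrix (Fin N × Fin n) (Fin N × Fin n) ℝ) : Prop :=
  IsAdjacencyMatrix G ∧ PS.PosDef ∧ PH.PosDef ∧
    IsNegDef (He (matA A C K G) PS + (2 * σ) • PS) ∧
    IsNegDef (boundedRealMatrix (matA A C K G) (matB K G) (X G) γ PH)

/-- `(𝒦, G, P_S, P_H)` solves the problem `inf tr(D)` subject to the constraints `Feasible`. -/
def IsOptimalSolution (A : Matrix (Fin n) (Fin n) ℝ) (C : Matrix (Fin p) (Fin n) ℝ)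
    (σ γ : ℝ) (X : OutputMatrix N n κ) (K : GainMatrix N n p) (G : Matrix (Fin N) (Fin N) ℝ)
    (PS PH : Matrix (Fin N × Fin n) (Fin N × Fin n) ℝ) : Prop :=
  Feasible A C σ γ X K G PS PH ∧
    ∀ K' G' PS' PH', Feasible A C σ γ X K' G' PS' PH' →
      (inDegreeMatrix G).trace ≤ (inDegreeMatrix G').trace

/-- The constraints are feasible in `(P_S, P_H)` for all slightly relaxed bounds
`σ' < σ` and `γ' > γ`. -/
def LimitFeasible (A : Matrix (Fin n) (Fin n) ℝ) (C : Matrix (Fin p) (Fin n) ℝ)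
    (σ γ : ℝ) (X : OutputMatrix N n κ) (K : GainMatrix N n p)
    (G : Matrix (Fin N) (Fin N) ℝ) : Prop :=
  ∀ σ' < σ, ∀ γ' > γ, ∃ PS PH, Feasible A C σ' γ' X K G PS PH

/-- `(𝒦, G)` solves the problem `inf tr(D)` subject to the constraints `LimitFeasible`. -/
def IsLimitOptimal (A : Matrix (Fin n) (Fin n) ℝ) (C : Matrix (Fin p) (Fin n) ℝ)
    (σ γ : ℝ) (X : OutputMatrix N n κ) (K : GainMatrix N n p)
    (G : Matrix (Fin N) (Fin N) ℝ) : Prop :=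
  LimitFeasible A C σ γ X K G ∧
    ∀ K' G', LimitFeasible A C σ γ X K' G' →
      (inDegreeMatrix G).trace ≤ (inDegreeMatrix G').trace

/-- The least number of edges of a digraph that meets the specifications with some gain
(`⊤` if there is none). -/
def minEdges (A : Matrix (Fin n) (Fin n) ℝ) (C : Matrix (Fin p) (Fin n) ℝ)
    (σ γ : ℝ) (X : OutputMatrix N n κ) : EReal :=
  sInf {v | ∃ Γ K, MeetsSpecs A C σ γ X Γ K ∧ v = ((numEdges Γ : ℝ) : EReal)}

/-- The value `inf tr(D)` of the optimization problem (`⊤` if it is infeasible). -/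
def optimalValue (A : Matrix (Fin n) (Fin n) ℝ) (C : Matrix (Fin p) (Fin n) ℝ)
    (σ γ : ℝ) (X : OutputMatrix N n κ) : EReal :=
  sInf {v | ∃ K G PS PH, Feasible A C σ γ X K G PS PH ∧
    v = (((inDegreeMatrix G).trace : ℝ) : EReal)}

end Observers

end InterconnectedObservers

end

open InterconnectedObservers

open scoped Matrix Kronecker

/-! For a fixed gain and digraph the constraints split into two independent matrix inequalities: the
one in `PS` is equivalent to all eigenvalues lying left of `-σ` (Lyapunov, shifted by `σ`), the one
in `PH` to stability together with an `H_∞` norm below `γ` (strict bounded real lemma). Since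
`tr(D)` is the sum of the entries of `G`, it counts edges, and the statements about minimizers and
values follow. The non-strict specifications are the limits of the strict ones as the bounds are
relaxed.

The substance is the converse direction: producing `P` from spectral or frequency data. Both cases
come from one strict Kalman-Yakubovich-Popov lemma, `exists_symm_isNegDef_of_frequency`, which needs
no controllability. If no `P` solves `Fᵀ P J + Jᵀ P F + Θ < 0`, convex separation gives a nonzero `W
≥ 0` with `F W Jᵀ + J W Fᵀ = 0` and `tr(W Θ) ≥ 0`. The skew relation lets one write `W` as a sum of
complex rank-one terms `w w*` with `J w = 0` or `F w = iω J w`. The frequency condition makes `Θ`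
negative on each nonzero `w`, so `tr(W Θ) < 0`, a contradiction.

This `P` is only symmetric. For Hurwitz `M`, positivity follows from `He M P < 0`: the form of `P`
strictly decreases along the Cayley transform of `M`, whose powers tend to zero. -/

namespace InterconnectedObservers

/-! ### Pencils with a skew-adjointness relation -/

section KalmanYakubovichPopov

open scoped InnerProductSpace

variable {ι κ : Type*} [Fintype ι] [DecidableEq ι] [Fintype κ] [DecidableEq κ]

/-- If `F G† + G F† = 0`, then some orthonormal basis consists of vectors that are killed by `G`
or are eigenvectors, with imaginary eigenvalue, of the pencil `(F, G)`. -/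
theorem exists_orthonormalBasis_imaginary_pencil {E H : Type*}
    [NormedAddCommGroup E] [InnerProductSpace ℂ E] [FiniteDimensional ℂ E]
    [NormedAddCommGroup H] [InnerProductSpace ℂ H] [FiniteDimensional ℂ H]
    (F G : E →ₗ[ℂ] H)
    (h : ∀ a, F (G.adjoint a) + G (F.adjoint a) = 0) :
    ∃ (r s : ℕ) (b : OrthonormalBasis (Fin r ⊕ Fin s) ℂ E),
      ∀ k, G (b k) = 0 ∨ ∃ ω : ℝ, F (b k) = (Complex.I * ω) • G (b k) := by
  -- `K` is the range of `G†`. On it `G` is injective, so `F` can be compared with `G` through `Z =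
  -- G⁻¹ F`.
  set K : Submodule ℂ E := (LinearMap.ker G)ᗮ with hK
  have hrange : ∀ u ∈ K, ∃ a, G.adjoint a = u := by
    intro u hu
    rw [hK, LinearMap.orthogonal_ker] at hu
    exact hu
  have hperp : ∀ v ∈ Kᗮ, G v = 0 := by
    intro v hv
    rw [hK, Submodule.orthogonal_orthogonal] at hv
    exact hv
  set GK : K →ₗ[ℂ] H := G ∘ₗ K.subtype with hGK
  have hinj : Function.Injective GK := by
    rw [← LinearMap.ker_eq_bot, LinearMap.ker_eq_bot']
    intro u hu
    have h1 : (u : E) ∈ LinearMap.ker G := hu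
    have h2 : ⟪(u : E), (u : E)⟫_ℂ = 0 := (Submodule.mem_orthogonal _ _).1 u.2 _ h1
    exact Subtype.ext (inner_self_eq_zero.1 h2)
  -- For `u = G† a` the hypothesis gives `F u = -G (F† a)`; the part of `F† a` outside `K` is killed
  -- by `G`.
  have hFr : ∀ u : K, F u ∈ LinearMap.range GK := by
    intro u
    obtain ⟨a, ha⟩ := hrange u u.2
    have hsplit : F.adjoint a = K.starProjection (F.adjoint a)
        + (F.adjoint a - K.starProjection (F.adjoint a)) := by abel
    have hker : G (F.adjoint a - K.starProjection (F.adjoint a)) = 0 :=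
      hperp _ (Submodule.sub_starProjection_mem_orthogonal _)
    refine ⟨-⟨K.starProjection (F.adjoint a), Submodule.starProjection_apply_mem _ _⟩, ?_⟩
    have h2 := h a
    rw [ha, hsplit, map_add, hker, add_zero] at h2
    rw [map_neg, eq_comm]
    exact eq_neg_of_add_eq_zero_left h2
  set e := LinearEquiv.ofInjective GK hinj with he
  set Z : K →ₗ[ℂ] K := e.symm.toLinearMap ∘ₗ (F ∘ₗ K.subtype).codRestrict _ hFr with hZ
  have hGZ : ∀ u : K, G (Z u) = F u := by
    intro u
    have h1 : e (Z u) = (F ∘ₗ K.subtype).codRestrict _ hFr u := by simp [hZ]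
    exact congrArg Subtype.val h1
  -- `Z` is skew-adjoint: with `u = G† a` and `v = G† b`, both `⟪Z u, v⟫` and `-⟪u, Z v⟫` equal `⟪F
  -- u, b⟫`. The spectral theorem then applies to `iZ`.
  have hsymm : (Complex.I • Z).IsSymmetric := by
    intro u v
    obtain ⟨a, ha⟩ := hrange u u.2
    obtain ⟨b, hb⟩ := hrange v v.2
    have h1 : ⟪(Z u : E), (v : E)⟫_ℂ = ⟪F u, b⟫_ℂ := by
      rw [← hb, LinearMap.adjoint_inner_right, hGZ]
    have h2 : ⟪(u : E), (Z v : E)⟫_ℂ = ⟪a, F v⟫_ℂ := by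
      rw [← ha, LinearMap.adjoint_inner_left, hGZ]
    have h3 : ⟪a, F v⟫_ℂ = - ⟪F u, b⟫_ℂ := by
      rw [← LinearMap.adjoint_inner_left, ← hb, LinearMap.adjoint_inner_right,
        eq_neg_of_add_eq_zero_right (h a), inner_neg_left, ha]
    simp only [LinearMap.smul_apply, inner_smul_left, inner_smul_right, Submodule.coe_inner,
      Complex.conj_I]
    rw [h1, h2, h3]
    ring
  have hrfl : Module.finrank ℂ K = Module.finrank ℂ K := rfl
  refine ⟨_, _, ((hsymm.eigenvectorBasis hrfl).prod
    (stdOrthonormalBasis ℂ Kᗮ)).map K.orthogonalDecomposition.symm, ?_⟩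
  rintro (k | k)
  · right
    refine ⟨-(hsymm.eigenvalues hrfl k), ?_⟩
    have h1 := hsymm.apply_eigenvectorBasis hrfl k
    set v := hsymm.eigenvectorBasis hrfl k with hv
    have h2 : Z v = (Complex.I * ((-(hsymm.eigenvalues hrfl k) : ℝ) : ℂ)) • v := by
      have h3 : Z v = -(Complex.I • ((Complex.I • Z) v)) := by
        rw [LinearMap.smul_apply, smul_smul, Complex.I_mul_I, neg_one_smul, neg_neg]
      rw [h3, h1, smul_smul, ← neg_smul]
      congr 1
      push_cast
      ring_nf
      rfl
    have h4 : F v = (Complex.I * ((-(hsymm.eigenvalues hrfl k) : ℝ) : ℂ)) • G v := by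
      rw [← hGZ, h2]
      simp
    simpa [← hv] using h4
  · left
    simpa using hperp _ (stdOrthonormalBasis ℂ Kᗮ k).2

end KalmanYakubovichPopov

/-! ### Duality for linear matrix inequalities -/

section KalmanYakubovichPopovMatrix

open Matrix

variable {ι κ : Type*} [Fintype ι] [Fintype κ]

/-- The real matrices with negative definite quadratic form. -/
def negDefForms (κ : Type*) [Fintype κ] : Set (Matrix κ κ ℝ) :=
  {Y | ∀ x : κ → ℝ, x ≠ 0 → x ⬝ᵥ (Y *ᵥ x) < 0}

theorem convex_negDefForms : Convex ℝ (negDefForms κ) := by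
  intro Y hY Z hZ a b ha hb hab x hx
  simp only [add_mulVec, smul_mulVec, dotProduct_add, dotProduct_smul, smul_eq_mul]
  have h1 := hY x hx
  have h2 := hZ x hx
  rcases ha.eq_or_lt with rfl | ha'
  · have : b = 1 := by linarith
    subst this
    linarith
  · have := mul_neg_of_pos_of_neg ha' h1
    have := mul_nonpos_of_nonneg_of_nonpos hb h2.le
    linarith

/-- Negativity on the compact unit sphere survives small perturbations, and homogeneity extends it
to all nonzero vectors. Leaving out symmetry is what makes the set open in the full matrix space, as
the separation theorem requires. -/
theorem isOpen_negDefForms : IsOpen (negDefForms κ) := by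
  rw [isOpen_iff_mem_nhds]
  intro Y hY
  have hcont : Continuous fun z : Matrix κ κ ℝ × (κ → ℝ) => z.2 ⬝ᵥ (z.1 *ᵥ z.2) :=
    Continuous.dotProduct continuous_snd (Continuous.matrix_mulVec continuous_fst continuous_snd)
  have h1 : ∀ᶠ Z in nhds Y, ∀ x ∈ Metric.sphere (0 : κ → ℝ) 1, x ⬝ᵥ (Z *ᵥ x) < 0 := by
    refine (isCompact_sphere _ _).eventually_forall_of_forall_eventually fun x hx => ?_
    refine (isOpen_lt hcont continuous_const).mem_nhds (hY x ?_)
    rintro rfl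
    simp at hx
  filter_upwards [h1] with Z hZ x hx
  have hn : 0 < ‖x‖ := norm_pos_iff.2 hx
  have h2 := hZ (‖x‖⁻¹ • x) (by simp [norm_smul, hn.ne'])
  simp only [mulVec_smul, dotProduct_smul, smul_dotProduct, smul_eq_mul] at h2
  by_contra hcon
  push Not at hcon
  have : 0 ≤ ‖x‖⁻¹ * (‖x‖⁻¹ * x ⬝ᵥ Z *ᵥ x) := by positivity
  linarith

theorem isNegDef_iff_mem_negDefForms {Y : Matrix κ κ ℝ} (hY : Y.IsSymm) :
    IsNegDef Y ↔ Y ∈ negDefForms κ := by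
  have hH : (-Y).IsHermitian := by
    rw [IsHermitian, conjTranspose_eq_transpose_of_trivial, transpose_neg, hY]
  rw [IsNegDef, posDef_iff_dotProduct_mulVec]
  simp only [hH, true_and, neg_mulVec, dotProduct_neg, star_trivial, negDefForms, Set.mem_ofPred_eq,
    neg_pos]

/-- A linear functional on real matrices is given, on symmetric matrices, by the trace pairing
with a symmetric matrix. -/
theorem exists_symm_trace_eq [DecidableEq κ] (f : Matrix κ κ ℝ →ₗ[ℝ] ℝ) :
    ∃ W : Matrix κ κ ℝ, W.IsSymm ∧ ∀ Y : Matrix κ κ ℝ, Y.IsSymm → f Y = (W * Y).trace := by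
  refine ⟨of fun i j => (f (single i j 1) + f (single j i 1)) / 2, ?_, ?_⟩
  · ext i j
    simp [add_comm]
  · intro Y hY
    have h1 : f Y = ∑ i, ∑ j, Y i j * f (single i j 1) := by
      conv_lhs => rw [matrix_eq_sum_single Y]
      simp only [map_sum]
      refine Finset.sum_congr rfl fun i _ => Finset.sum_congr rfl fun j _ => ?_
      rw [← smul_eq_mul, ← map_smul, smul_single, smul_eq_mul, mul_one]
    have h2 : f Y = ∑ i, ∑ j, Y i j * f (single j i 1) := by
      rw [h1, Finset.sum_comm]
      refine Finset.sum_congr rfl fun i _ => Finset.sum_congr rfl fun j _ => ?_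
      rw [hY.apply]
    have h3 : (of (fun i j => (f (single i j 1) + f (single j i 1)) / 2) * Y).trace
        = (∑ i, ∑ j, Y i j * f (single i j 1) + ∑ i, ∑ j, Y i j * f (single j i 1)) / 2 := by
      simp only [trace, diag, mul_apply, of_apply, ← Finset.sum_add_distrib, Finset.sum_div]
      refine Finset.sum_congr rfl fun i _ => Finset.sum_congr rfl fun j _ => ?_
      rw [hY.apply]
      ring
    rw [h3, ← h1, ← h2]
    ring

theorem trace_mul_vecMulVec (W : Matrix κ κ ℝ) (x : κ → ℝ) :
    (W * vecMulVec x x).trace = x ⬝ᵥ (W *ᵥ x) := by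
  rw [mul_vecMulVec, trace_vecMulVec, dotProduct_comm]

/-- If no symmetric `P` satisfies the matrix inequality, then there is a dual certificate. -/
theorem exists_dual_certificate [DecidableEq κ] (F J : Matrix ι κ ℝ) {Θ : Matrix κ κ ℝ} (hΘ : Θ.IsSymm)
    (h : ¬ ∃ P : Matrix ι ι ℝ, P.IsSymm ∧ IsNegDef (Fᵀ * P * J + Jᵀ * P * F + Θ)) :
    ∃ W : Matrix κ κ ℝ, W.PosSemidef ∧ W ≠ 0 ∧ F * W * Jᵀ + J * W * Fᵀ = 0 ∧
      0 ≤ (W * Θ).trace := by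
  have hsym : ∀ P : Matrix ι ι ℝ, P.IsSymm → (Fᵀ * P * J + Jᵀ * P * F).IsSymm := by
    intro P hP
    simp only [IsSymm, transpose_add, transpose_mul, transpose_transpose, hP.eq, Matrix.mul_assoc]
    exact add_comm _ _
  have hconv : Convex ℝ {Y | ∃ P : Matrix ι ι ℝ, P.IsSymm ∧
      Y = Fᵀ * P * J + Jᵀ * P * F + Θ} := by
    rintro _ ⟨P, hP, rfl⟩ _ ⟨Q, hQ, rfl⟩ a b ha hb hab
    refine ⟨a • P + b • Q, ?_, ?_⟩
    · simp [IsSymm, hP.eq, hQ.eq]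
    · have : Θ = a • Θ + b • Θ := by rw [← add_smul, hab, one_smul]
      simp only [Matrix.mul_add, Matrix.add_mul, Matrix.mul_smul, Matrix.smul_mul, smul_add]
      conv_rhs => rw [this]
      abel
  have hdisj : Disjoint (negDefForms κ) {Y | ∃ P : Matrix ι ι ℝ, P.IsSymm ∧
      Y = Fᵀ * P * J + Jᵀ * P * F + Θ} := by
    rw [Set.disjoint_left]
    rintro _ hY ⟨P, hP, rfl⟩
    exact h ⟨P, hP, (isNegDef_iff_mem_negDefForms ((hsym P hP).add hΘ)).2 hY⟩
  obtain ⟨f, u, hf1, hf2⟩ :=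
    geometric_hahn_banach_open convex_negDefForms isOpen_negDefForms hconv hdisj
  have hnegone : ∀ t : ℝ, 0 < t → t • (-1 : Matrix κ κ ℝ) ∈ negDefForms κ := by
    intro t ht x hx
    have : 0 < x ⬝ᵥ x := by
      have := dotProduct_star_self_pos_iff.2 hx
      simpa using this
    simp only [smul_mulVec, neg_mulVec, one_mulVec, dotProduct_smul, dotProduct_neg, smul_eq_mul]
    nlinarith
  -- The cone contains `-t I` for arbitrarily small `t > 0`, where `f` is arbitrarily close to `0`;
  -- a negative `u` is refuted by the `t` with `t * f (-1) = u / 2`.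
  have hu : 0 ≤ u := by
    by_contra hcon
    push Not at hcon
    have h1 : ∀ t : ℝ, 0 < t → t * f (-1) < u := by
      intro t ht
      simpa using hf1 _ (hnegone t ht)
    have h2 := h1 1 one_pos
    have h3 : f (-1) < 0 := by linarith
    have h4 := h1 (u / (2 * f (-1))) (div_pos_of_neg_of_neg hcon (by linarith))
    have h5 : u / (2 * f (-1)) * f (-1) = u / 2 := by
      have := h3.ne
      field_simp
    linarith
  -- A functional bounded below on an affine space vanishes on its direction: otherwise the scaling
  -- chosen here brings the value of `f` down to `u - 1`.
  have hlin : ∀ P : Matrix ι ι ℝ, P.IsSymm → f (Fᵀ * P * J + Jᵀ * P * F) = 0 := by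
    intro P hP
    by_contra hne
    set c := f (Fᵀ * P * J + Jᵀ * P * F) with hc
    have h1 := hf2 _ ⟨((u - f Θ - 1) / c) • P, by simp [IsSymm, hP.eq], rfl⟩
    have h2 : f (Fᵀ * (((u - f Θ - 1) / c) • P) * J + Jᵀ * (((u - f Θ - 1) / c) • P) * F + Θ)
        = (u - f Θ - 1) / c * c + f Θ := by
      rw [hc, map_add]
      simp only [Matrix.mul_smul, Matrix.smul_mul, ← smul_add, map_smul, smul_eq_mul]
    rw [h2, div_mul_cancel₀ _ hne] at h1
    linarith
  have hΘ0 : u ≤ f Θ := by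
    simpa using hf2 _ ⟨0, by simp [IsSymm], rfl⟩
  obtain ⟨W, hW, hfW⟩ := exists_symm_trace_eq (f : Matrix κ κ ℝ →ₗ[ℝ] ℝ)
  have hfW' : ∀ Y : Matrix κ κ ℝ, Y.IsSymm → f Y = (W * Y).trace := hfW
  have hone : f (-1) < u := by simpa using hf1 _ (hnegone 1 one_pos)
  refine ⟨W, ?_, ?_, ?_, ?_⟩
  · refine PosSemidef.of_dotProduct_mulVec_nonneg ?_ fun x => ?_
    · rw [IsHermitian, conjTranspose_eq_transpose_of_trivial, hW]
    · have hxx : (vecMulVec x x).IsSymm := by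
        ext i j
        simp [vecMulVec_apply, mul_comm]
      have h1 := hfW' _ hxx
      rw [trace_mul_vecMulVec] at h1
      rw [star_trivial, ← h1]
      by_contra hcon
      push Not at hcon
      -- Subtracting `t x xᵀ` from `-I` stays in the cone. If `f (x xᵀ)` were negative, a suitable
      -- `t` would bring the value up to `u` exactly.
      have h2 : ∀ t : ℝ, 0 ≤ t → f (-1) - t * f (vecMulVec x x) < u := by
        intro t ht
        have h3 : (1 : ℝ) • (-1 : Matrix κ κ ℝ) + -(t • vecMulVec x x) ∈ negDefForms κ := by
          intro y hy
          have h4 := hnegone 1 one_pos y hy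
          have h5 : 0 ≤ y ⬝ᵥ (vecMulVec x x *ᵥ y) := by
            rw [vecMulVec_mulVec, dotProduct_smul]
            simp only [MulOpposite.smul_eq_mul_unop, MulOpposite.unop_op]
            rw [dotProduct_comm y x]
            exact mul_self_nonneg _
          have h6 : y ⬝ᵥ (t • vecMulVec x x) *ᵥ y = t * (y ⬝ᵥ (vecMulVec x x *ᵥ y)) := by
            rw [smul_mulVec, dotProduct_smul, smul_eq_mul]
          rw [add_mulVec, dotProduct_add, neg_mulVec _ (t • _), dotProduct_neg, h6]
          have := mul_nonneg ht h5
          linarith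
        have h6 := hf1 _ h3
        rw [map_add, one_smul, map_neg f (t • _), map_smul, smul_eq_mul] at h6
        linarith
      have h7 := h2 ((u - f (-1)) / (-f (vecMulVec x x)))
        (div_nonneg (by linarith) (by linarith))
      have h8 : (u - f (-1)) / (-f (vecMulVec x x)) * f (vecMulVec x x) = -(u - f (-1)) := by
        have := hcon.ne
        field_simp
      linarith
  · rintro rfl
    have h1 := hfW' (-1) (by simp [IsSymm])
    have h2 := hfW' Θ hΘ
    rw [Matrix.zero_mul, trace_zero] at h1 h2
    linarith
  -- Testing `hlin` with the symmetric matrix `P = S` itself gives `tr(Sᵀ S) = 0`.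
  · set S := F * W * Jᵀ + J * W * Fᵀ with hS
    have hSsymm : S.IsSymm := by
      simp only [hS, IsSymm, transpose_add, transpose_mul, transpose_transpose, hW.eq,
        Matrix.mul_assoc]
      exact add_comm _ _
    have h1 := hlin S hSsymm
    rw [hfW' _ (hsym S hSsymm)] at h1
    have h2 : (W * (Fᵀ * S * J + Jᵀ * S * F)).trace = (Sᴴ * S).trace := by
      have e1 : (W * (Fᵀ * S * J)).trace = (J * W * Fᵀ * S).trace := by
        rw [trace_mul_comm, Matrix.mul_assoc, Matrix.mul_assoc, trace_mul_comm]
        rw [Matrix.mul_assoc, trace_mul_comm, Matrix.mul_assoc, Matrix.mul_assoc,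
          ← Matrix.mul_assoc J, ← Matrix.mul_assoc]
      have e2 : (W * (Jᵀ * S * F)).trace = (F * W * Jᵀ * S).trace := by
        rw [trace_mul_comm, Matrix.mul_assoc, Matrix.mul_assoc, trace_mul_comm]
        rw [Matrix.mul_assoc, trace_mul_comm, Matrix.mul_assoc, Matrix.mul_assoc,
          ← Matrix.mul_assoc F, ← Matrix.mul_assoc]
      rw [Matrix.mul_add, trace_add, e1, e2, ← trace_add, ← Matrix.add_mul, add_comm,
        conjTranspose_eq_transpose_of_trivial, hSsymm.eq]
    rw [h2] at h1
    exact trace_conjTranspose_mul_self_eq_zero_iff.1 h1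
  · rw [← hfW' Θ hΘ]
    linarith

end KalmanYakubovichPopovMatrix

/-! ### The strict Kalman-Yakubovich-Popov lemma -/

section KalmanYakubovichPopovStrict

open Matrix

variable {ι κ : Type*} [Fintype ι] [DecidableEq ι] [Fintype κ] [DecidableEq κ]

theorem map_ofReal_mul {l m n : Type*} [Fintype m] (M : Matrix l m ℝ) (N : Matrix m n ℝ) :
    (M * N).map Complex.ofReal = M.map Complex.ofReal * N.map Complex.ofReal :=
  Matrix.map_mul (f := Complex.ofRealHom)

theorem map_ofReal_conjTranspose {l m : Type*} (M : Matrix l m ℝ) :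
    (M.map Complex.ofReal)ᴴ = Mᵀ.map Complex.ofReal := by
  ext i j
  simp

theorem trace_eq_sum_orthonormalBasis {r : Type*} [Fintype r] (T : Matrix κ κ ℂ)
    (b : OrthonormalBasis r ℂ (EuclideanSpace ℂ κ)) :
    T.trace = ∑ k, star (b k).ofLp ⬝ᵥ (T *ᵥ (b k).ofLp) := by
  have h1 : LinearMap.trace ℂ _ (toEuclideanLin T) = T.trace := by
    rw [toEuclideanLin_eq_toLin_orthonormal, trace_toLin_eq]
  rw [← h1, LinearMap.trace_eq_sum_inner _ b]
  refine Finset.sum_congr rfl fun k _ => ?_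
  rw [EuclideanSpace.inner_eq_star_dotProduct, dotProduct_comm]
  rfl

/-- The strict Kalman-Yakubovich-Popov lemma: the frequency domain inequality implies the
linear matrix inequality. -/
theorem exists_symm_isNegDef_of_frequency (F J : Matrix ι κ ℝ) {Θ : Matrix κ κ ℝ}
    (hΘ : Θ.IsSymm)
    (h : ∀ w : κ → ℂ, w ≠ 0 →
      (J.map Complex.ofReal *ᵥ w = 0 ∨
        ∃ ω : ℝ, F.map Complex.ofReal *ᵥ w = (Complex.I * ω) • (J.map Complex.ofReal *ᵥ w)) →
      (star w ⬝ᵥ (Θ.map Complex.ofReal *ᵥ w)).re < 0) :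
    ∃ P : Matrix ι ι ℝ, P.IsSymm ∧ IsNegDef (Fᵀ * P * J + Jᵀ * P * F + Θ) := by
  by_contra hcon
  obtain ⟨W, hW, hW0, hskew, htr⟩ := exists_dual_certificate F J hΘ hcon
  obtain ⟨B, rfl⟩ := by
    open scoped MatrixOrder in
    exact CStarAlgebra.nonneg_iff_eq_star_mul_self.mp hW.nonneg
  rw [star_eq_conjTranspose, conjTranspose_eq_transpose_of_trivial] at *
  set L : Matrix κ κ ℂ := Bᵀ.map Complex.ofReal with hL
  have hLH : Lᴴ = B.map Complex.ofReal := by rw [hL, map_ofReal_conjTranspose, transpose_transpose]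
  -- With `W = L Lᴴ`, the dual relation is the skewness hypothesis of the pencil lemma for `F L` and
  -- `J L`. The vectors `L (b k)` are then admissible test vectors whenever they are nonzero.
  have hFG : (F.map Complex.ofReal * L) * (J.map Complex.ofReal * L)ᴴ
      + (J.map Complex.ofReal * L) * (F.map Complex.ofReal * L)ᴴ = 0 := by
    have h1 := congrArg (fun M => M.map Complex.ofReal) hskew
    simp only [Matrix.map_add _ Complex.ofReal_add, map_ofReal_mul] at h1
    rw [conjTranspose_mul, conjTranspose_mul, hLH, map_ofReal_conjTranspose,
      map_ofReal_conjTranspose]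
    simp only [Matrix.mul_assoc] at h1 ⊢
    rw [h1]
    ext i j
    simp
  obtain ⟨r, s, b, hb⟩ := exists_orthonormalBasis_imaginary_pencil
    (toEuclideanLin (F.map Complex.ofReal * L)) (toEuclideanLin (J.map Complex.ofReal * L)) (by
      intro a
      rw [← toEuclideanLin_conjTranspose_eq_adjoint, ← toEuclideanLin_conjTranspose_eq_adjoint]
      refine (WithLp.ofLp_injective 2) ?_
      have h1 := congrArg (fun M => M *ᵥ a.ofLp) hFG
      simp only [add_mulVec, ← mulVec_mulVec, zero_mulVec] at h1
      simpa [toLpLin_apply, ← mulVec_mulVec] using h1)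
  have hneg : ∀ k, L *ᵥ (b k).ofLp ≠ 0 →
      (star (L *ᵥ (b k).ofLp) ⬝ᵥ (Θ.map Complex.ofReal *ᵥ (L *ᵥ (b k).ofLp))).re < 0 := by
    intro k hk
    refine h _ hk ?_
    rcases hb k with h0 | ⟨ω, hω⟩
    · left
      have := congrArg WithLp.ofLp h0
      simpa [toLpLin_apply, ← mulVec_mulVec] using this
    · right
      refine ⟨ω, ?_⟩
      have := congrArg WithLp.ofLp hω
      simpa [toLpLin_apply, ← mulVec_mulVec] using this
  have htrace : ((Bᵀ * B * Θ).trace : ℝ) = ∑ k,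
      (star (L *ᵥ (b k).ofLp) ⬝ᵥ (Θ.map Complex.ofReal *ᵥ (L *ᵥ (b k).ofLp))).re := by
    have h1 : (((Bᵀ * B * Θ).trace : ℝ) : ℂ) = (Lᴴ * Θ.map Complex.ofReal * L).trace := by
      rw [hLH, hL, ← map_ofReal_mul, ← map_ofReal_mul, Matrix.mul_assoc Bᵀ, trace_mul_comm]
      simp [trace]
    rw [← Complex.re_sum, ← Complex.ofReal_re (Bᵀ * B * Θ).trace, h1,
      trace_eq_sum_orthonormalBasis _ b]
    congr 1
    refine Finset.sum_congr rfl fun k _ => ?_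
    rw [star_mulVec, ← dotProduct_mulVec, mulVec_mulVec, mulVec_mulVec, Matrix.mul_assoc]
  have hterm : ∀ k,
      (star (L *ᵥ (b k).ofLp) ⬝ᵥ (Θ.map Complex.ofReal *ᵥ (L *ᵥ (b k).ofLp))).re ≤ 0 := by
    intro k
    by_cases hk : L *ᵥ (b k).ofLp = 0
    · simp [hk]
    · exact (hneg k hk).le
  -- A sum of nonpositive terms equals `tr(W Θ) ≥ 0`, so no term is negative and every test vector
  -- vanishes. Hence `L = 0`, against `W ≠ 0`.
  have hzero : ∀ k, L *ᵥ (b k).ofLp = 0 := by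
    intro k
    by_contra hk
    have := Finset.sum_lt_sum (s := Finset.univ) (fun k _ => hterm k)
      ⟨k, Finset.mem_univ _, hneg k hk⟩
    rw [← htrace, Finset.sum_const_zero] at this
    linarith
  have hL0 : toEuclideanLin L = 0 := by
    refine b.toBasis.ext fun k => ?_
    refine (WithLp.ofLp_injective 2) ?_
    simpa [toLpLin_apply] using hzero k
  have hB0 : L = 0 := by simpa using hL0
  apply hW0
  have : Bᵀ = 0 := by
    ext i j
    have := congrFun (congrFun hB0 i) j
    simpa [hL] using this
  rw [this, Matrix.zero_mul]

end KalmanYakubovichPopovStrict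

/-! ### Lyapunov inequalities -/

section Lyapunov

open Matrix Filter Topology

variable {ι κ : Type*} [Fintype ι] [Fintype κ]

theorem re_star_dotProduct_map_mulVec (Y : Matrix κ κ ℝ) (w : κ → ℂ) :
    (star w ⬝ᵥ (Y.map Complex.ofReal *ᵥ w)).re =
      (fun i => (w i).re) ⬝ᵥ (Y *ᵥ fun i => (w i).re) +
        (fun i => (w i).im) ⬝ᵥ (Y *ᵥ fun i => (w i).im) := by
  simp [dotProduct, mulVec, ← Finset.sum_add_distrib, Complex.mul_re]

theorem IsNegDef.re_lt_zero {Y : Matrix κ κ ℝ} (hY : IsNegDef Y) {w : κ → ℂ} (hw : w ≠ 0) :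
    (star w ⬝ᵥ (Y.map Complex.ofReal *ᵥ w)).re < 0 := by
  have hlt : ∀ x : κ → ℝ, x ≠ 0 → x ⬝ᵥ (Y *ᵥ x) < 0 := by
    intro x hx
    have := PosDef.dotProduct_mulVec_pos hY hx
    simpa [neg_mulVec] using this
  have hle : ∀ x : κ → ℝ, x ⬝ᵥ (Y *ᵥ x) ≤ 0 := by
    intro x
    by_cases hx : x = 0
    · simp [hx]
    · exact (hlt x hx).le
  rw [re_star_dotProduct_map_mulVec]
  by_cases hre : (fun i => (w i).re) = 0
  · have him : (fun i => (w i).im) ≠ 0 := by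
      intro him
      exact hw (funext fun i => Complex.ext (congrFun hre i) (congrFun him i))
    linarith [hlt _ him, hle fun i => (w i).re]
  · linarith [hlt _ hre, hle fun i => (w i).im]

/-- Both necessity arguments rest on this identity: for an eigenvector it ties the sign of `Re l` to
that of the form, and for imaginary `l` the matrix `P` drops out. -/
theorem re_star_dotProduct_of_pencil {F J : Matrix ι κ ℝ} {P : Matrix ι ι ℝ} {w : κ → ℂ} {l : ℂ}
    (h : F.map Complex.ofReal *ᵥ w = l • (J.map Complex.ofReal *ᵥ w)) :
    (star w ⬝ᵥ ((Fᵀ * P * J + Jᵀ * P * F).map Complex.ofReal *ᵥ w)).re =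
      2 * l.re * (star (J.map Complex.ofReal *ᵥ w) ⬝ᵥ
        (P.map Complex.ofReal *ᵥ (J.map Complex.ofReal *ᵥ w))).re := by
  set y := J.map Complex.ofReal *ᵥ w with hy
  have h1 : star w ⬝ᵥ ((Fᵀ * P * J).map Complex.ofReal *ᵥ w)
      = star l * (star y ⬝ᵥ (P.map Complex.ofReal *ᵥ y)) := by
    rw [map_ofReal_mul, map_ofReal_mul, ← map_ofReal_conjTranspose, ← mulVec_mulVec,
      ← mulVec_mulVec, dotProduct_mulVec, ← star_mulVec, h, star_smul, smul_dotProduct, ← hy,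
      smul_eq_mul]
  have h2 : star w ⬝ᵥ ((Jᵀ * P * F).map Complex.ofReal *ᵥ w)
      = l * (star y ⬝ᵥ (P.map Complex.ofReal *ᵥ y)) := by
    rw [map_ofReal_mul, map_ofReal_mul, ← map_ofReal_conjTranspose, ← mulVec_mulVec,
      ← mulVec_mulVec, dotProduct_mulVec, ← star_mulVec, h, mulVec_smul, dotProduct_smul, ← hy,
      smul_eq_mul]
  rw [Matrix.map_add _ Complex.ofReal_add, add_mulVec, dotProduct_add, h1, h2, ← add_mul]
  have h3 : star l + l = ((2 * l.re : ℝ) : ℂ) := by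
    rw [add_comm, ← Complex.add_conj]
    rfl
  rw [h3, Complex.re_ofReal_mul]

theorem isSymm_of_posDef {ι : Type*} {P : Matrix ι ι ℝ} (hP : P.PosDef) : P.IsSymm := by
  rw [IsSymm, ← conjTranspose_eq_transpose_of_trivial]
  exact hP.1

variable [DecidableEq ι]

theorem mem_spectrum_iff_exists_mulVec {M : Matrix ι ι ℂ} {l : ℂ} :
    l ∈ spectrum ℂ M ↔ ∃ v : ι → ℂ, v ≠ 0 ∧ M *ᵥ v = l • v := by
  rw [spectrum.mem_iff, isUnit_iff_isUnit_det, isUnit_iff_ne_zero, not_not,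
    ← exists_mulVec_eq_zero_iff]
  refine exists_congr fun v => and_congr_right fun _ => ?_
  rw [sub_mulVec, Algebra.algebraMap_eq_smul_one, smul_mulVec, one_mulVec, sub_eq_zero, eq_comm]

theorem mem_eig_iff {M : Matrix ι ι ℝ} {l : ℂ} :
    l ∈ eig M ↔ ∃ v : ι → ℂ, v ≠ 0 ∧ M.map Complex.ofReal *ᵥ v = l • v :=
  mem_spectrum_iff_exists_mulVec

theorem He_eq_of_isSymm {M P : Matrix ι ι ℝ} (hP : P.IsSymm) :
    He M P = Mᵀ * P * 1 + (1 : Matrix ι ι ℝ)ᵀ * P * M := by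
  rw [He, hP.eq, transpose_one, Matrix.mul_one, Matrix.one_mul]

theorem isHurwitz_of_isNegDef_He {M P : Matrix ι ι ℝ} (hP : P.PosDef) (h : IsNegDef (He M P)) :
    IsHurwitz M := by
  intro l hl
  obtain ⟨v, hv, hMv⟩ := mem_eig_iff.1 hl
  have h1 := h.re_lt_zero hv
  have hone : (1 : Matrix ι ι ℝ).map Complex.ofReal *ᵥ v = v := by
    rw [Matrix.map_one _ Complex.ofReal_zero Complex.ofReal_one, one_mulVec]
  rw [He_eq_of_isSymm (isSymm_of_posDef hP), re_star_dotProduct_of_pencil (l := l) (by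
    rw [hMv, hone]), hone] at h1
  have h2 : 0 < (star v ⬝ᵥ (P.map Complex.ofReal *ᵥ v)).re := by
    have h3 : IsNegDef (-P) := by rwa [IsNegDef, neg_neg]
    have h4 := h3.re_lt_zero hv
    have h5 : (-P).map Complex.ofReal = -(P.map Complex.ofReal) := by
      ext i j
      simp
    rw [h5, neg_mulVec, dotProduct_neg, Complex.neg_re] at h4
    linarith
  by_contra hcon
  push Not at hcon
  have := mul_nonneg (mul_nonneg zero_le_two hcon) h2.le
  linarith

-- By Gelfand's formula `‖S ^ m‖ ^ (1 / m)` tends to the spectral radius, so `‖S ^ m‖ ≤ r ^ m`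
-- eventually for some `r < 1`.
open scoped Matrix.Norms.L2Operator in
theorem tendsto_pow_zero_of_spectrum_lt_one [Nonempty ι] (S : Matrix ι ι ℂ)
    (h : ∀ k ∈ spectrum ℂ S, ‖k‖ < 1) : Tendsto (fun m : ℕ => S ^ m) atTop (𝓝 0) := by
  have h1 : spectralRadius ℂ S < (1 : NNReal) :=
    spectrum.spectralRadius_lt_of_forall_lt S (fun k hk => h k hk)
  obtain ⟨r, hr1, hr2⟩ := ENNReal.lt_iff_exists_nnreal_btwn.1 h1
  have h2 := (spectrum.pow_nnnorm_pow_one_div_tendsto_nhds_spectralRadius S).eventually_lt_const hr1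
  have hr : (r : ℝ) < 1 := by exact_mod_cast hr2
  refine squeeze_zero_norm' ?_ (tendsto_pow_atTop_nhds_zero_of_lt_one r.2 hr)
  filter_upwards [h2, eventually_gt_atTop 0] with m hm hm0
  have hm' : (m : ℝ) ≠ 0 := by positivity
  have h3 := ENNReal.rpow_le_rpow hm.le (Nat.cast_nonneg (α := ℝ) m)
  rw [← ENNReal.rpow_mul, one_div, inv_mul_cancel₀ hm', ENNReal.rpow_one,
    ENNReal.rpow_natCast] at h3
  exact_mod_cast h3

theorem map_ofReal_pow (S : Matrix ι ι ℝ) (m : ℕ) :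
    (S ^ m).map Complex.ofReal = S.map Complex.ofReal ^ m := by
  induction m with
  | zero => simp
  | succ m ih => rw [pow_succ, pow_succ, map_ofReal_mul, ih]

theorem IsHurwitz.isUnit_det_one_sub {M : Matrix ι ι ℝ} (hM : IsHurwitz M) :
    IsUnit (1 - M).det := by
  rw [isUnit_iff_ne_zero]
  intro h0
  obtain ⟨v, hv, hMv⟩ := exists_mulVec_eq_zero_iff.2 h0
  rw [sub_mulVec, one_mulVec, sub_eq_zero] at hMv
  have h1 : (1 : ℂ) ∈ eig M := by
    refine mem_eig_iff.2 ⟨fun i => (v i : ℂ), ?_, ?_⟩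
    · intro h
      exact hv (funext fun i => by simpa using congrFun h i)
    · ext i
      have := congrFun hMv i
      simp only [mulVec, dotProduct] at this
      simp [mulVec, dotProduct, this, ← Complex.ofReal_mul, ← Complex.ofReal_sum]
  have := hM 1 h1
  simp at this
  linarith

/-- The Cayley transform of a Hurwitz matrix has powers tending to zero. -/
theorem IsHurwitz.tendsto_cayley_pow [Nonempty ι] {M : Matrix ι ι ℝ} (hM : IsHurwitz M) :
    Tendsto (fun m : ℕ => ((1 + M) * (1 - M)⁻¹) ^ m) atTop (𝓝 0) := by
  set S := (1 + M) * (1 - M)⁻¹ with hS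
  have hdet := hM.isUnit_det_one_sub
  have hSM : S * (1 - M) = 1 + M := by
    rw [hS, Matrix.mul_assoc, nonsing_inv_mul _ hdet, Matrix.mul_one]
  have hSM' := congrArg (fun M => M.map Complex.ofReal) hSM
  have hinv := congrArg (fun M => M.map Complex.ofReal) (mul_nonsing_inv _ hdet)
  simp only [map_ofReal_mul, Matrix.map_add _ Complex.ofReal_add,
    Matrix.map_sub _ Complex.ofReal_sub,
    Matrix.map_one _ Complex.ofReal_zero Complex.ofReal_one] at hSM' hinv
  have hspec : ∀ k ∈ spectrum ℂ (S.map Complex.ofReal), ‖k‖ < 1 := by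
    intro k hk
    obtain ⟨w, hw, hSw⟩ := mem_spectrum_iff_exists_mulVec.1 hk
    set z := ((1 - M)⁻¹).map Complex.ofReal *ᵥ w with hz
    have hwz : w = (1 - M.map Complex.ofReal) *ᵥ z := by
      rw [hz, mulVec_mulVec, hinv, one_mulVec]
    have hz0 : z ≠ 0 := by
      intro h0
      rw [h0, mulVec_zero] at hwz
      exact hw hwz
    rw [hwz, mulVec_mulVec, hSM', add_mulVec, sub_mulVec, one_mulVec] at hSw
    have hkz : (1 + k) • (M.map Complex.ofReal *ᵥ z) = (k - 1) • z := by
      rw [add_smul, sub_smul, one_smul, one_smul]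
      rw [smul_sub] at hSw
      rw [← sub_eq_zero] at hSw ⊢
      rw [← hSw]
      abel
    have hk1 : 1 + k ≠ 0 := by
      intro h0
      rw [h0, zero_smul] at hkz
      have h1 : k - 1 ≠ 0 := by
        intro h1
        have : (2 : ℂ) = 0 := by linear_combination h0 - h1
        norm_num at this
      exact (smul_ne_zero h1 hz0) hkz.symm
    -- The inverse Cayley map sends the eigenvalue `k` of `S` to one of `M`, and it has negative
    -- real part exactly when `‖k‖ < 1`.
    have hmem : (k - 1) / (1 + k) ∈ eig M := by
      refine mem_eig_iff.2 ⟨z, hz0, ?_⟩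
      rw [div_eq_inv_mul, mul_smul, ← hkz, smul_smul, inv_mul_cancel₀ hk1, one_smul]
    have hre := hM _ hmem
    have hpos : 0 < Complex.normSq (1 + k) := Complex.normSq_pos.2 hk1
    rw [Complex.div_re, ← add_div, div_lt_iff₀ hpos, zero_mul] at hre
    simp only [Complex.sub_re, Complex.one_re, Complex.add_re, Complex.sub_im, Complex.one_im,
      Complex.add_im] at hre
    have hsq : ‖k‖ ^ 2 < 1 := by
      rw [Complex.sq_norm, Complex.normSq_apply]
      nlinarith
    nlinarith [norm_nonneg k]
  have h1 := tendsto_pow_zero_of_spectrum_lt_one _ hspec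
  refine tendsto_pi_nhds.2 fun i => tendsto_pi_nhds.2 fun j => ?_
  have h2 := (tendsto_pi_nhds.1 (tendsto_pi_nhds.1 h1 i) j)
  have h3 := (Complex.continuous_re.tendsto _).comp h2
  refine h3.congr fun m => ?_
  simp [← map_ofReal_pow]

/-- Lyapunov: a symmetric solution of the strict Lyapunov inequality for a Hurwitz matrix is
positive definite. -/
theorem IsHurwitz.posDef_of_isNegDef_He {M P : Matrix ι ι ℝ} (hM : IsHurwitz M) (hP : P.IsSymm)
    (h : IsNegDef (He M P)) : P.PosDef := by
  refine PosDef.of_dotProduct_mulVec_pos ?_ fun x hx => ?_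
  · rw [IsHermitian, conjTranspose_eq_transpose_of_trivial, hP]
  rw [star_trivial]
  have : Nonempty ι := by
    by_contra hcon
    rw [not_nonempty_iff] at hcon
    exact hx (Subsingleton.elim _ _)
  set S := (1 + M) * (1 - M)⁻¹ with hS
  have hdet := hM.isUnit_det_one_sub
  set V : (ι → ℝ) → ℝ := fun y => y ⬝ᵥ (P *ᵥ y) with hV
  -- Writing `y = z - M z` gives `S y = z + M z`, hence `V y - V (S y) = -2 zᵀ (He M P) z`. This is
  -- a discrete substitute for decay along `e^{tM}`.
  have hdec : ∀ y, y ≠ 0 → V (S *ᵥ y) < V y := by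
    intro y hy
    set z := (1 - M)⁻¹ *ᵥ y with hz
    have hyz : y = z - M *ᵥ z := by
      have h1 : z - M *ᵥ z = (1 - M) *ᵥ z := by rw [sub_mulVec, one_mulVec]
      rw [h1, hz, mulVec_mulVec, mul_nonsing_inv _ hdet, one_mulVec]
    have hSy : S *ᵥ y = z + M *ᵥ z := by
      rw [hS, ← mulVec_mulVec, add_mulVec, one_mulVec]
    have hz0 : z ≠ 0 := by
      intro h0
      rw [h0, mulVec_zero, sub_zero] at hyz
      exact hy hyz
    have h1 := PosDef.dotProduct_mulVec_pos h hz0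
    rw [star_trivial, neg_mulVec, dotProduct_neg, He, hP.eq, add_mulVec, dotProduct_add,
      ← mulVec_mulVec, ← mulVec_mulVec, dotProduct_mulVec z Mᵀ, vecMul_transpose] at h1
    rw [hSy]
    conv_rhs => rw [hyz]
    simp only [hV, mulVec_add, mulVec_sub, dotProduct_add, dotProduct_sub, add_dotProduct,
      sub_dotProduct]
    linarith
  have hle : ∀ y, V (S *ᵥ y) ≤ V y := by
    intro y
    by_cases hy : y = 0
    · simp [hy, hV]
    · exact (hdec y hy).le
  have hanti : ∀ m : ℕ, V (S ^ m *ᵥ (S *ᵥ x)) ≤ V (S *ᵥ x) := by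
    intro m
    induction m with
    | zero => simp
    | succ m ih =>
      rw [pow_succ', ← mulVec_mulVec]
      exact (hle _).trans ih
  have hcont : Continuous fun T : Matrix ι ι ℝ => V (T *ᵥ (S *ᵥ x)) := by
    have h1 : Continuous fun T : Matrix ι ι ℝ => T *ᵥ (S *ᵥ x) :=
      Continuous.matrix_mulVec continuous_id continuous_const
    exact h1.dotProduct (Continuous.matrix_mulVec continuous_const h1)
  have hlim := (hcont.tendsto 0).comp hM.tendsto_cayley_pow
  have h0 : V ((0 : Matrix ι ι ℝ) *ᵥ (S *ᵥ x)) = 0 := by simp [hV]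
  rw [h0] at hlim
  -- Starting the orbit at `S x` rather than `x` leaves one strict decrease to turn `0 ≤ V (S x)`
  -- into `0 < V x`.
  have hge : 0 ≤ V (S *ᵥ x) := le_of_tendsto' hlim hanti
  exact hge.trans_lt (hdec x hx)

/-- Lyapunov's theorem. -/
theorem exists_lyapunov_iff {M : Matrix ι ι ℝ} :
    (∃ P : Matrix ι ι ℝ, P.PosDef ∧ IsNegDef (He M P)) ↔ IsHurwitz M := by
  constructor
  · rintro ⟨P, hP, h⟩
    exact isHurwitz_of_isNegDef_He hP h
  · intro hM
    -- With `J = 1` and `Θ = 0` an admissible vector would be an eigenvector of `M` with imaginary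
    -- eigenvalue; there is none, so the frequency condition is vacuous.
    obtain ⟨P, hP, h⟩ := exists_symm_isNegDef_of_frequency M 1 (Θ := 0) (by simp [IsSymm]) (by
      intro w hw hor
      exfalso
      rw [Matrix.map_one _ Complex.ofReal_zero Complex.ofReal_one, one_mulVec] at hor
      rcases hor with h0 | ⟨ω, hω⟩
      · exact hw h0
      · have := hM _ (mem_eig_iff.2 ⟨w, hw, hω⟩)
        simp at this)
    rw [add_zero, ← He_eq_of_isSymm hP] at h
    exact ⟨P, hM.posDef_of_isNegDef_He hP h, h⟩

/-- Lyapunov's theorem with a decay rate. -/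
theorem exists_lyapunov_shift_iff {M : Matrix ι ι ℝ} {σ : ℝ} :
    (∃ P : Matrix ι ι ℝ, P.PosDef ∧ IsNegDef (He M P + (2 * σ) • P)) ↔
      ∀ l ∈ eig M, l.re < -σ := by
  have h1 : ∀ P : Matrix ι ι ℝ, P.PosDef →
      He M P + (2 * σ) • P = He (M + σ • (1 : Matrix ι ι ℝ)) P := by
    intro P hP
    rw [He, He, (isSymm_of_posDef hP).eq, transpose_add, transpose_smul, transpose_one,
      Matrix.add_mul, Matrix.mul_add, Matrix.smul_mul, Matrix.mul_smul, Matrix.one_mul,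
      Matrix.mul_one, two_mul, add_smul]
    abel
  have h2 : (M + σ • (1 : Matrix ι ι ℝ)).map Complex.ofReal
      = M.map Complex.ofReal + (σ : ℂ) • 1 := by
    ext i j
    by_cases hij : i = j <;> simp [hij]
  have h3 : (∀ l ∈ eig M, l.re < -σ) ↔ IsHurwitz (M + σ • (1 : Matrix ι ι ℝ)) := by
    constructor
    · intro h l hl
      obtain ⟨v, hv, hl⟩ := mem_eig_iff.1 hl
      have h4 : l - σ ∈ eig M := by
        refine mem_eig_iff.2 ⟨v, hv, ?_⟩
        rw [h2, add_mulVec, smul_mulVec, one_mulVec] at hl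
        rw [sub_smul, ← hl, add_sub_cancel_right]
      have := h _ h4
      rw [Complex.sub_re, Complex.ofReal_re] at this
      linarith
    · intro h l hl
      obtain ⟨v, hv, hl⟩ := mem_eig_iff.1 hl
      have h4 : l + σ ∈ eig (M + σ • (1 : Matrix ι ι ℝ)) := by
        refine mem_eig_iff.2 ⟨v, hv, ?_⟩
        rw [h2, add_mulVec, smul_mulVec, one_mulVec, hl, add_smul]
      have := h _ h4
      rw [Complex.add_re, Complex.ofReal_re] at this
      linarith
  rw [h3, ← exists_lyapunov_iff]
  exact exists_congr fun P => and_congr_right fun hP => by rw [h1 P hP]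

end Lyapunov

/-! ### The bounded real lemma -/

section BoundedReal

set_option linter.unusedSectionVars false

open Matrix Filter Topology

variable {ι ν κ : Type*} [Fintype ι] [Fintype ν] [Fintype κ]

theorem isNegDef_fromBlocks_schur_iff [DecidableEq κ] {Y : Matrix ι ι ℝ} (hY : Y.IsSymm)
    (Z : Matrix κ ι ℝ) {γ : ℝ} (hγ : 0 < γ) :
    IsNegDef (fromBlocks Y Zᵀ Z (-(γ • (1 : Matrix κ κ ℝ)))) ↔
      IsNegDef (Y + γ⁻¹ • (Zᵀ * Z)) := by
  have hs1 : (fromBlocks Y Zᵀ Z (-(γ • (1 : Matrix κ κ ℝ)))).IsSymm := by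
    refine IsSymm.fromBlocks hY rfl ?_
    simp [IsSymm]
  have hs2 : (Y + γ⁻¹ • (Zᵀ * Z)).IsSymm := by
    simp [IsSymm, hY.eq, transpose_mul]
  rw [isNegDef_iff_mem_negDefForms hs1, isNegDef_iff_mem_negDefForms hs2]
  have hq1 : ∀ (w : ι → ℝ) (z : κ → ℝ),
      Sum.elim w z ⬝ᵥ (fromBlocks Y Zᵀ Z (-(γ • (1 : Matrix κ κ ℝ))) *ᵥ Sum.elim w z)
        = w ⬝ᵥ (Y *ᵥ w) + 2 * (z ⬝ᵥ (Z *ᵥ w)) - γ * (z ⬝ᵥ z) := by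
    intro w z
    rw [fromBlocks_mulVec, sumElim_dotProduct_sumElim]
    simp only [Sum.elim_comp_inl, Sum.elim_comp_inr, dotProduct_add, neg_mulVec, smul_mulVec,
      one_mulVec, dotProduct_neg, dotProduct_smul, smul_eq_mul]
    rw [dotProduct_mulVec w Zᵀ, vecMul_transpose, dotProduct_comm (Z *ᵥ w) z]
    ring
  have hq2 : ∀ w : ι → ℝ, w ⬝ᵥ ((Y + γ⁻¹ • (Zᵀ * Z)) *ᵥ w)
      = w ⬝ᵥ (Y *ᵥ w) + γ⁻¹ * ((Z *ᵥ w) ⬝ᵥ (Z *ᵥ w)) := by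
    intro w
    rw [add_mulVec, dotProduct_add, smul_mulVec, dotProduct_smul, ← mulVec_mulVec,
      dotProduct_mulVec w Zᵀ, vecMul_transpose, smul_eq_mul]
  constructor
  · intro h w hw
    -- For fixed `w`, this second component maximizes the quadratic form.
    have h1 := h (Sum.elim w (γ⁻¹ • (Z *ᵥ w))) (by
      intro h0
      exact hw (funext fun i => congrFun h0 (Sum.inl i)))
    rw [hq1] at h1
    rw [hq2]
    simp only [smul_dotProduct, dotProduct_smul, smul_eq_mul] at h1
    have h2 : γ * (γ⁻¹ * (γ⁻¹ * ((Z *ᵥ w) ⬝ᵥ (Z *ᵥ w)))) = γ⁻¹ * ((Z *ᵥ w) ⬝ᵥ (Z *ᵥ w)) := by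
      field_simp
    linarith
  · intro h v hv
    obtain ⟨w, z, rfl⟩ : ∃ w z, v = Sum.elim w z :=
      ⟨v ∘ Sum.inl, v ∘ Sum.inr, (Sum.elim_comp_inl_inr v).symm⟩
    rw [hq1]
    by_cases hw : w = 0
    · subst hw
      have hz : z ≠ 0 := by
        rintro rfl
        apply hv
        ext (i | i) <;> rfl
      have h1 : 0 < z ⬝ᵥ z := by
        have := dotProduct_star_self_pos_iff.2 hz
        simpa using this
      have := mul_pos hγ h1
      simp only [mulVec_zero, dotProduct_zero]
      linarith
    · have h1 := h w hw
      rw [hq2] at h1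
      -- Completing the square in `z`.
      have h2 : 0 ≤ (γ • z - Z *ᵥ w) ⬝ᵥ (γ • z - Z *ᵥ w) := by
        have := dotProduct_star_self_nonneg (γ • z - Z *ᵥ w)
        simpa only [star_trivial] using this
      simp only [dotProduct_sub, sub_dotProduct, smul_dotProduct, dotProduct_smul,
        smul_eq_mul] at h2
      rw [dotProduct_comm (Z *ᵥ w) z] at h2
      have h3 := mul_nonneg (inv_pos.2 hγ).le h2
      have h4 : γ⁻¹ * (γ * (γ * (z ⬝ᵥ z) - z ⬝ᵥ (Z *ᵥ w))
          - (γ * (z ⬝ᵥ (Z *ᵥ w)) - (Z *ᵥ w) ⬝ᵥ (Z *ᵥ w)))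
          = γ * (z ⬝ᵥ z) - 2 * (z ⬝ᵥ (Z *ᵥ w)) + γ⁻¹ * ((Z *ᵥ w) ⬝ᵥ (Z *ᵥ w)) := by
        field_simp
        ring
      linarith

variable [DecidableEq ι] [DecidableEq ν]

/-- The supply rate `γ⁻¹ |X x|² - γ |u|²` of the bounded real lemma, as a matrix. -/
noncomputable def supplyRate (ν : Type*) [Fintype ν] [DecidableEq ν] (X : Matrix κ ι ℝ) (γ : ℝ) :
    Matrix (ι ⊕ ν) (ι ⊕ ν) ℝ :=
  fromBlocks 0 0 0 (-(γ • (1 : Matrix ν ν ℝ)))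
    + γ⁻¹ • ((fromCols X (0 : Matrix κ ν ℝ))ᵀ * fromCols X (0 : Matrix κ ν ℝ))

theorem isSymm_supplyRate (X : Matrix κ ι ℝ) (γ : ℝ) : (supplyRate ν X γ).IsSymm := by
  rw [supplyRate]
  refine IsSymm.add (IsSymm.fromBlocks (by simp [IsSymm]) (by simp) (by simp [IsSymm])) ?_
  simp only [IsSymm, transpose_smul, transpose_mul, transpose_transpose]

theorem isSymm_fromBlocks_He {M P : Matrix ι ι ℝ} (hP : P.IsSymm) (B : Matrix ι ν ℝ) (γ : ℝ) :
    (fromBlocks (He M P) (P * B) (Bᵀ * P) (-(γ • (1 : Matrix ν ν ℝ)))).IsSymm := by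
  refine IsSymm.fromBlocks ?_ ?_ ?_
  · simp only [IsSymm, He, transpose_add, transpose_mul, transpose_transpose]
    exact add_comm _ _
  · rw [transpose_mul, hP.eq]
  · simp [IsSymm]

theorem isSymm_boundedRealMatrix [DecidableEq κ] {M P : Matrix ι ι ℝ} (hP : P.IsSymm)
    (B : Matrix ι ν ℝ) (X : Matrix κ ι ℝ) (γ : ℝ) : (boundedRealMatrix M B X γ P).IsSymm := by
  rw [boundedRealMatrix]
  refine IsSymm.fromBlocks (isSymm_fromBlocks_He hP B γ) ?_ ?_
  · rw [transpose_fromRows, transpose_transpose, transpose_zero]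
  · simp [IsSymm]

/-- Eliminating the output block by a Schur complement gives the Kalman-Yakubovich-Popov form with
`F = [M B]` and `J = [1 0]`. -/
theorem isNegDef_boundedRealMatrix_iff [DecidableEq κ] {M P : Matrix ι ι ℝ} (hP : P.IsSymm)
    (B : Matrix ι ν ℝ) (X : Matrix κ ι ℝ) {γ : ℝ} (hγ : 0 < γ) :
    IsNegDef (boundedRealMatrix M B X γ P) ↔
      IsNegDef ((fromCols M B)ᵀ * P * fromCols (1 : Matrix ι ι ℝ) (0 : Matrix ι ν ℝ)
        + (fromCols (1 : Matrix ι ι ℝ) (0 : Matrix ι ν ℝ))ᵀ * P * fromCols M B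
        + supplyRate ν X γ) := by
  have h1 : fromRows Xᵀ (0 : Matrix ν κ ℝ) = (fromCols X (0 : Matrix κ ν ℝ))ᵀ := by
    rw [transpose_fromCols, transpose_zero]
  rw [boundedRealMatrix, h1, isNegDef_fromBlocks_schur_iff (isSymm_fromBlocks_He hP B γ) _ hγ,
    supplyRate, ← add_assoc]
  congr! 2
  simp only [transpose_fromCols, transpose_one, transpose_zero, fromRows_mul, mul_fromCols,
    Matrix.mul_one, Matrix.mul_zero, Matrix.one_mul, Matrix.zero_mul, He, hP.eq]
  ext (i | i) (j | j) <;> simp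

theorem norm_toLp_sq {m : Type*} [Fintype m] (v : m → ℂ) :
    ‖WithLp.toLp 2 v‖ ^ 2 = (star v ⬝ᵥ v).re := by
  rw [EuclideanSpace.norm_sq_eq, dotProduct, Complex.re_sum]
  refine Finset.sum_congr rfl fun i _ => ?_
  simp [Complex.sq_norm, Complex.normSq_apply]

theorem re_star_dotProduct_supplyRate (X : Matrix κ ι ℝ) (γ : ℝ) (x : ι → ℂ) (u : ν → ℂ) :
    (star (Sum.elim x u) ⬝ᵥ ((supplyRate ν X γ).map Complex.ofReal *ᵥ Sum.elim x u)).re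
      = γ⁻¹ * ‖WithLp.toLp 2 (X.map Complex.ofReal *ᵥ x)‖ ^ 2 - γ * ‖WithLp.toLp 2 u‖ ^ 2 := by
  have h1 : (fromCols X (0 : Matrix κ ν ℝ)).map Complex.ofReal *ᵥ Sum.elim x u
      = X.map Complex.ofReal *ᵥ x := by
    ext k
    simp [mulVec, dotProduct]
  have h2 : (supplyRate ν X γ).map Complex.ofReal
      = fromBlocks 0 0 0 (-((γ : ℂ) • (1 : Matrix ν ν ℂ)))
        + ((γ⁻¹ : ℝ) : ℂ) • (((fromCols X (0 : Matrix κ ν ℝ)).map Complex.ofReal)ᴴ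
          * (fromCols X (0 : Matrix κ ν ℝ)).map Complex.ofReal) := by
    rw [map_ofReal_conjTranspose, ← map_ofReal_mul, supplyRate,
      Matrix.map_add _ Complex.ofReal_add, fromBlocks_map]
    congr 1
    · ext (i | i) (j | j)
      · simp
      · simp
      · simp
      · by_cases hij : i = j <;> simp [hij, one_apply]
    · ext i j
      simp
  have h3 : star (Sum.elim x u) = Sum.elim (star x) (star u) := by
    ext (i | i) <;> rfl
  rw [h2, add_mulVec, dotProduct_add, smul_mulVec, dotProduct_smul, ← mulVec_mulVec, h1,
    dotProduct_mulVec _ (_ᴴ), ← star_mulVec, h1, h3, fromBlocks_mulVec,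
    sumElim_dotProduct_sumElim, norm_toLp_sq, norm_toLp_sq]
  simp only [Sum.elim_comp_inl, Sum.elim_comp_inr, zero_mulVec, zero_add, dotProduct_zero,
    neg_mulVec, smul_mulVec, one_mulVec, dotProduct_neg, dotProduct_smul, smul_eq_mul,
    Complex.add_re, Complex.neg_re, Complex.re_ofReal_mul]
  ring

theorem map_fromCols_mulVec (M : Matrix κ ι ℝ) (B : Matrix κ ν ℝ) (x : ι → ℂ) (u : ν → ℂ) :
    (fromCols M B).map Complex.ofReal *ᵥ Sum.elim x u
      = M.map Complex.ofReal *ᵥ x + B.map Complex.ofReal *ᵥ u := by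
  ext k
  simp [mulVec, dotProduct]

theorem map_fromCols_one_zero_mulVec (x : ι → ℂ) (u : ν → ℂ) :
    (fromCols (1 : Matrix ι ι ℝ) (0 : Matrix ι ν ℝ)).map Complex.ofReal *ᵥ Sum.elim x u = x := by
  rw [map_fromCols_mulVec, Matrix.map_one _ Complex.ofReal_zero Complex.ofReal_one, one_mulVec,
    Matrix.map_zero _ Complex.ofReal_zero, zero_mulVec, add_zero]

theorem IsHurwitz.isUnit_det_resolvent {M : Matrix ι ι ℝ} (hM : IsHurwitz M) (ω : ℝ) :
    IsUnit ((Complex.I * ω) • (1 : Matrix ι ι ℂ) - M.map Complex.ofReal).det := by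
  rw [isUnit_iff_ne_zero]
  intro h0
  obtain ⟨v, hv, hMv⟩ := exists_mulVec_eq_zero_iff.2 h0
  rw [sub_mulVec, smul_mulVec, one_mulVec, sub_eq_zero] at hMv
  have := hM _ (mem_eig_iff.2 ⟨v, hv, hMv.symm⟩)
  simp at this

theorem transferFunction_mulVec {M : Matrix ι ι ℝ} (B : Matrix ι ν ℝ) (X : Matrix κ ι ℝ) (s : ℂ)
    (u : ν → ℂ) : transferFunction M B X s *ᵥ u = X.map Complex.ofReal *ᵥ
      ((s • (1 : Matrix ι ι ℂ) - M.map Complex.ofReal)⁻¹ *ᵥ (B.map Complex.ofReal *ᵥ u)) := by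
  rw [transferFunction, mulVec_mulVec, mulVec_mulVec]

open scoped Matrix.Norms.L2Operator in
theorem norm_toLp_mulVec_le (T : Matrix κ ν ℂ) (u : ν → ℂ) :
    ‖WithLp.toLp 2 (T *ᵥ u)‖ ≤ ‖T‖ * ‖WithLp.toLp 2 u‖ :=
  l2_opNorm_mulVec T (WithLp.toLp 2 u)

open scoped Matrix.Norms.L2Operator in
theorem l2_opNorm_le_of_forall (T : Matrix κ ν ℂ) {c : ℝ} (hc : 0 ≤ c)
    (h : ∀ u : ν → ℂ, ‖WithLp.toLp 2 (T *ᵥ u)‖ ≤ c * ‖WithLp.toLp 2 u‖) : ‖T‖ ≤ c := by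
  rw [l2_opNorm_def]
  exact ContinuousLinearMap.opNorm_le_bound _ hc fun x => h x.ofLp

-- The vector `(x, u)` with `x = (iω - M)⁻¹ B u` satisfies `F w = iω J w`, so the terms in `P`
-- cancel and only `γ⁻¹ |T u|² - γ |u|² ≤ 0` remains.
open scoped Matrix.Norms.L2Operator in
theorem norm_transferFunction_le [DecidableEq κ] {M P : Matrix ι ι ℝ} (hM : IsHurwitz M)
    (hP : P.IsSymm) {B : Matrix ι ν ℝ} {X : Matrix κ ι ℝ} {γ : ℝ} (hγ : 0 < γ)
    (h : IsNegDef (boundedRealMatrix M B X γ P)) (ω : ℝ) :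
    ‖transferFunction M B X (Complex.I * ω)‖ ≤ γ := by
  refine l2_opNorm_le_of_forall _ hγ.le fun u => ?_
  rw [isNegDef_boundedRealMatrix_iff hP B X hγ] at h
  rw [transferFunction_mulVec]
  set x := ((Complex.I * ω) • (1 : Matrix ι ι ℂ) - M.map Complex.ofReal)⁻¹ *ᵥ
    (B.map Complex.ofReal *ᵥ u) with hx
  have h1 : ((Complex.I * ω) • (1 : Matrix ι ι ℂ) - M.map Complex.ofReal) *ᵥ x
      = B.map Complex.ofReal *ᵥ u := by
    rw [hx, mulVec_mulVec, mul_nonsing_inv _ (hM.isUnit_det_resolvent ω), one_mulVec]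
  rw [sub_mulVec, smul_mulVec, one_mulVec] at h1
  have h2 : (fromCols M B).map Complex.ofReal *ᵥ Sum.elim x u = (Complex.I * ω) •
      ((fromCols (1 : Matrix ι ι ℝ) (0 : Matrix ι ν ℝ)).map Complex.ofReal *ᵥ Sum.elim x u) := by
    rw [map_fromCols_mulVec, map_fromCols_one_zero_mulVec, ← h1, add_sub_cancel]
  have h3 := re_star_dotProduct_of_pencil (P := P) h2
  have h4 : (star (Sum.elim x u) ⬝ᵥ (((fromCols M B)ᵀ * P * fromCols (1 : Matrix ι ι ℝ) (0 : Matrix ι ν ℝ)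
      + (fromCols (1 : Matrix ι ι ℝ) (0 : Matrix ι ν ℝ))ᵀ * P * fromCols M B + supplyRate ν X γ).map Complex.ofReal *ᵥ
        Sum.elim x u)).re ≤ 0 := by
    by_cases hw : Sum.elim x u = 0
    · simp [hw]
    · exact (h.re_lt_zero hw).le
  rw [Matrix.map_add _ Complex.ofReal_add, add_mulVec, dotProduct_add, Complex.add_re, h3,
    re_star_dotProduct_supplyRate] at h4
  have h5 : (Complex.I * (ω : ℂ)).re = 0 := by simp
  rw [h5, mul_zero, zero_mul, zero_add] at h4
  refine (sq_le_sq₀ (norm_nonneg _) (by positivity)).1 ?_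
  have h6 := mul_le_mul_of_nonneg_left h4 hγ.le
  rw [mul_zero, mul_sub, ← mul_assoc, mul_inv_cancel₀ hγ.ne', one_mul] at h6
  rw [mul_pow, sq γ]
  linarith

-- The admissible vectors `(x, u)` are of two kinds. Those with `x = 0` play the role of infinite
-- frequency and give `-γ |u|²`; the others have `x = (iω - M)⁻¹ B u` and give `γ⁻¹ |T u|² - γ
-- |u|²`. A bound at each finite frequency, not uniform in `ω`, is therefore enough.
open scoped Matrix.Norms.L2Operator in
theorem exists_isNegDef_boundedRealMatrix [DecidableEq κ] {M : Matrix ι ι ℝ} (hM : IsHurwitz M)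
    {B : Matrix ι ν ℝ} {X : Matrix κ ι ℝ} {γ : ℝ} (hγ : 0 < γ)
    (h : ∀ ω : ℝ, ‖transferFunction M B X (Complex.I * ω)‖ < γ) :
    ∃ P : Matrix ι ι ℝ, P.IsSymm ∧ IsNegDef (boundedRealMatrix M B X γ P) := by
  obtain ⟨P, hP, hneg⟩ := exists_symm_isNegDef_of_frequency (fromCols M B)
    (fromCols (1 : Matrix ι ι ℝ) (0 : Matrix ι ν ℝ))
    (isSymm_supplyRate (ν := ν) X γ) (by
      intro w hw hor
      obtain ⟨x, u, rfl⟩ : ∃ x u, w = Sum.elim x u :=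
        ⟨w ∘ Sum.inl, w ∘ Sum.inr, (Sum.elim_comp_inl_inr w).symm⟩
      rw [re_star_dotProduct_supplyRate]
      rw [map_fromCols_one_zero_mulVec] at hor
      -- If `u = 0`, then `x ≠ 0` would be an eigenvector of the Hurwitz matrix `M` with imaginary
      -- eigenvalue.
      have hu : 0 < ‖WithLp.toLp 2 u‖ := by
        rw [norm_pos_iff]
        intro hu
        have hu0 : u = 0 := congrArg WithLp.ofLp hu
        subst hu0
        have hx : x ≠ 0 := by
          rintro rfl
          apply hw
          ext (i | i) <;> rfl
        rcases hor with h0 | ⟨ω, hω⟩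
        · exact hx h0
        · rw [map_fromCols_mulVec, mulVec_zero, add_zero] at hω
          have := hM _ (mem_eig_iff.2 ⟨x, hx, hω⟩)
          simp at this
      rcases hor with h0 | ⟨ω, hω⟩
      · rw [h0, mulVec_zero]
        have : 0 < γ * ‖WithLp.toLp 2 u‖ ^ 2 := by positivity
        simpa using this
      · rw [map_fromCols_mulVec] at hω
        have h1 : B.map Complex.ofReal *ᵥ u
            = ((Complex.I * ω) • (1 : Matrix ι ι ℂ) - M.map Complex.ofReal) *ᵥ x := by
          rw [sub_mulVec, smul_mulVec, one_mulVec, ← hω, add_sub_cancel_left]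
        have h2 : X.map Complex.ofReal *ᵥ x
            = transferFunction M B X (Complex.I * ω) *ᵥ u := by
          rw [transferFunction_mulVec, h1, mulVec_mulVec x,
            nonsing_inv_mul _ (hM.isUnit_det_resolvent ω), one_mulVec]
        have h3 : ‖WithLp.toLp 2 (X.map Complex.ofReal *ᵥ x)‖ < γ * ‖WithLp.toLp 2 u‖ := by
          rw [h2]
          exact (norm_toLp_mulVec_le _ _).trans_lt (mul_lt_mul_of_pos_right (h ω) hu)
        have h4 := pow_lt_pow_left₀ h3 (norm_nonneg _) two_ne_zero
        have h5 := mul_lt_mul_of_pos_left h4 (inv_pos.2 hγ)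
        have h6 : γ⁻¹ * (γ * ‖WithLp.toLp 2 u‖) ^ 2 = γ * ‖WithLp.toLp 2 u‖ ^ 2 := by
          field_simp
        linarith)
  exact ⟨P, hP, (isNegDef_boundedRealMatrix_iff hP B X hγ).2 hneg⟩

theorem isNegDef_He_of_boundedRealMatrix [DecidableEq κ] {M P : Matrix ι ι ℝ} {B : Matrix ι ν ℝ}
    {X : Matrix κ ι ℝ} {γ : ℝ} (h : IsNegDef (boundedRealMatrix M B X γ P)) :
    IsNegDef (He M P) := by
  have h1 := PosDef.submatrix h (e := fun i : ι => Sum.inl (Sum.inl i))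
    (Sum.inl_injective.comp Sum.inl_injective)
  have h2 : (-boundedRealMatrix M B X γ P).submatrix (fun i : ι => Sum.inl (Sum.inl i))
      (fun i : ι => Sum.inl (Sum.inl i)) = -He M P := rfl
  rwa [h2] at h1

/-- Positivity is read off the output block because the noise block is empty when `p = 0`. -/
theorem pos_of_isNegDef_boundedRealMatrix [DecidableEq κ] [Nonempty κ] {M P : Matrix ι ι ℝ}
    {B : Matrix ι ν ℝ} {X : Matrix κ ι ℝ} {γ : ℝ} (h : IsNegDef (boundedRealMatrix M B X γ P)) :
    0 < γ := by
  obtain ⟨k⟩ := ‹Nonempty κ›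
  simpa [boundedRealMatrix] using PosDef.diag_pos h (i := Sum.inr k)

open scoped Matrix.Norms.L2Operator in
/-- The strict bounded real lemma. -/
theorem exists_boundedReal_iff [DecidableEq κ] [Nonempty κ] {M : Matrix ι ι ℝ}
    {B : Matrix ι ν ℝ} {X : Matrix κ ι ℝ} {γ : ℝ} :
    (∃ P : Matrix ι ι ℝ, P.PosDef ∧ IsNegDef (boundedRealMatrix M B X γ P)) ↔
      IsHurwitz M ∧ hInfNorm (transferFunction M B X) < (γ : EReal) := by
  constructor
  · rintro ⟨P, hP, h⟩
    have hM := isHurwitz_of_isNegDef_He hP (isNegDef_He_of_boundedRealMatrix h)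
    refine ⟨hM, ?_⟩
    have hPs := isSymm_of_posDef hP
    have hγ := pos_of_isNegDef_boundedRealMatrix h
    have hcont : Continuous fun g : ℝ => boundedRealMatrix M B X g P := by
      unfold boundedRealMatrix
      fun_prop
    -- Frequency-wise bounds by `γ` would only give a supremum `≤ γ`. Since the matrix inequality is
    -- an open condition, it still holds for some `g < γ`, which makes the bound strict.
    have h1 : ∀ᶠ g in 𝓝 γ, boundedRealMatrix M B X g P ∈ negDefForms ((ι ⊕ ν) ⊕ κ) :=
      hcont.continuousAt.eventually (isOpen_negDefForms.mem_nhds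
        ((isNegDef_iff_mem_negDefForms (isSymm_boundedRealMatrix hPs B X γ)).1 h))
    have h2 := (h1.and (lt_mem_nhds hγ)).filter_mono (nhdsWithin_le_nhds (s := Set.Iio γ))
    obtain ⟨g, ⟨hg, hg0⟩, hgγ⟩ := (h2.and self_mem_nhdsWithin).exists
    rw [← isNegDef_iff_mem_negDefForms (isSymm_boundedRealMatrix hPs B X g)] at hg
    refine lt_of_le_of_lt (iSup_le fun ω => ?_) (EReal.coe_lt_coe_iff.2 hgγ)
    exact EReal.coe_le_coe_iff.2 (norm_transferFunction_le hM hPs hg0 hg ω)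
  · rintro ⟨hM, h⟩
    have h1 : ∀ ω : ℝ, ‖transferFunction M B X (Complex.I * ω)‖ < γ := fun ω =>
      EReal.coe_lt_coe_iff.1 (lt_of_le_of_lt (le_iSup
        (fun ω : ℝ => ((‖transferFunction M B X (Complex.I * ω)‖ : ℝ) : EReal)) ω) h)
    have hγ : 0 < γ := (norm_nonneg _).trans_lt (h1 0)
    obtain ⟨P, hP, hneg⟩ := exists_isNegDef_boundedRealMatrix hM hγ h1
    exact ⟨P, hM.posDef_of_isNegDef_He hP (isNegDef_He_of_boundedRealMatrix hneg), hneg⟩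

end BoundedReal

/-! ### From matrix inequalities to edge-minimal designs -/

section Designs

set_option linter.unusedSectionVars false

open Matrix

theorem isGreatest_spectralAbscissa {ι : Type*} [Fintype ι] [DecidableEq ι] [Nonempty ι]
    (M : Matrix ι ι ℝ) : IsGreatest (Complex.re '' eig M) (spectralAbscissa M) := by
  have hfin : (Complex.re '' eig M).Finite := (Matrix.finite_spectrum _).image _
  have hne : (Complex.re '' eig M).Nonempty :=
    (spectrum.nonempty_of_isAlgClosed_of_finiteDimensional ℂ _).image _
  exact ⟨hne.csSup_mem hfin, fun _ h => le_csSup hfin.bddAbove h⟩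

theorem IsHurwitz.convergenceRate_eq {ι : Type*} [Fintype ι] [DecidableEq ι] [Nonempty ι]
    {M : Matrix ι ι ℝ} (hM : IsHurwitz M) : convergenceRate M = -spectralAbscissa M := by
  obtain ⟨l, hl, he⟩ := (isGreatest_spectralAbscissa M).1
  rw [convergenceRate, abs_of_neg]
  rw [← he]
  exact hM l hl

theorem IsHurwitz.lt_convergenceRate_iff {ι : Type*} [Fintype ι] [DecidableEq ι] [Nonempty ι]
    {M : Matrix ι ι ℝ} (hM : IsHurwitz M) {σ : ℝ} :
    σ < convergenceRate M ↔ ∀ l ∈ eig M, l.re < -σ := by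
  rw [hM.convergenceRate_eq, lt_neg]
  constructor
  · intro h l hl
    exact ((isGreatest_spectralAbscissa M).2 ⟨l, hl, rfl⟩).trans_lt h
  · intro h
    obtain ⟨l, hl, he⟩ := (isGreatest_spectralAbscissa M).1
    rw [← he]
    exact h l hl

variable {N n p : ℕ}

theorem isAdjacencyMatrix_adjacency_iff {Γ : Digraph (Fin N)} :
    IsAdjacencyMatrix (adjacency Γ) ↔ IsSelfConnected Γ := by
  constructor
  · rintro ⟨-, h⟩ i
    by_contra hcon
    have := h i
    simp [adjacency, hcon] at this
  · intro h
    refine ⟨fun i j => ?_, fun i => ?_⟩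
    · by_cases hij : Γ.Adj i j <;> simp [adjacency, hij]
    · simp [adjacency, h i]

theorem IsAdjacencyMatrix.exists_digraph {G : Matrix (Fin N) (Fin N) ℝ}
    (hG : IsAdjacencyMatrix G) : ∃ Γ : Digraph (Fin N), adjacency Γ = G := by
  refine ⟨⟨fun i j => G i j = 1⟩, ?_⟩
  ext i j
  rcases hG.1 i j with h | h <;> simp [adjacency, h]

theorem trace_inDegreeMatrix_adjacency (Γ : Digraph (Fin N)) :
    (inDegreeMatrix (adjacency Γ)).trace = numEdges Γ := by
  classical
  rw [inDegreeMatrix, trace_diagonal, numEdges, Finset.sum_comm,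
    ← Fintype.sum_prod_type' (fun i j => adjacency Γ i j),
    Set.ncard_eq_toFinset_card']
  simp [adjacency, Finset.sum_boole]

variable {κ : Type} [Fintype κ] [DecidableEq κ]
variable {A : Matrix (Fin n) (Fin n) ℝ} {C : Matrix (Fin p) (Fin n) ℝ} {σ γ : ℝ}
  {X : OutputMatrix N n κ}

/-- The two inequalities have separate unknowns, so they can be solved independently. Stability is
extracted from the one in `PH`: for `σ < 0` the one in `PS` does not imply it. -/
theorem exists_feasible_iff [Nonempty κ] {K : GainMatrix N n p} {G : Matrix (Fin N) (Fin N) ℝ} :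
    (∃ PS PH, Feasible A C σ γ X K G PS PH) ↔
      IsAdjacencyMatrix G ∧ IsHurwitz (matA A C K G) ∧ (∀ l ∈ eig (matA A C K G), l.re < -σ) ∧
        hInfNorm (errorTransfer A C X K G) < (γ : EReal) := by
  rw [← exists_lyapunov_shift_iff, errorTransfer]
  constructor
  · rintro ⟨PS, PH, hG, hPS, hPH, hS, hH⟩
    have := exists_boundedReal_iff.1 ⟨PH, hPH, hH⟩
    exact ⟨hG, this.1, ⟨PS, hPS, hS⟩, this.2⟩
  · rintro ⟨hG, hM, ⟨PS, hPS, hS⟩, hT⟩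
    obtain ⟨PH, hPH, hH⟩ := exists_boundedReal_iff.2 ⟨hM, hT⟩
    exact ⟨PS, PH, hG, hPS, hPH, hS, hH⟩

theorem meetsSpecs_iff [Nonempty κ] [NeZero N] [NeZero n] {Γ : Digraph (Fin N)}
    {K : GainMatrix N n p} :
    MeetsSpecs A C σ γ X Γ K ↔ ∃ PS PH, Feasible A C σ γ X K (adjacency Γ) PS PH := by
  rw [exists_feasible_iff, MeetsSpecs, isAdjacencyMatrix_adjacency_iff]
  refine and_congr_right fun _ => and_congr_right fun hM => ?_
  rw [hM.lt_convergenceRate_iff]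

/-- A non-strict bound amounts to all relaxed strict ones. Stability involves no limit, since every
relaxed problem already certifies it for the same `𝒜`; the relaxations by `1` are arbitrary choices.
-/
theorem meetsSpecsNonstrict_iff [Nonempty κ] [NeZero N] [NeZero n] {Γ : Digraph (Fin N)}
    {K : GainMatrix N n p} :
    MeetsSpecsNonstrict A C σ γ X Γ K ↔ LimitFeasible A C σ γ X K (adjacency Γ) := by
  have h : LimitFeasible A C σ γ X K (adjacency Γ) ↔
      ∀ σ' < σ, ∀ γ' > γ, MeetsSpecs A C σ' γ' X Γ K := by
    simp only [LimitFeasible, meetsSpecs_iff]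
  rw [h]
  constructor
  · rintro ⟨hΓ, hM, hσ, hγ⟩ σ' hσ' γ' hγ'
    exact ⟨hΓ, hM, hσ'.trans_le hσ, hγ.trans_lt (EReal.coe_lt_coe_iff.2 hγ')⟩
  · intro h
    obtain ⟨hΓ, hM, -, -⟩ := h (σ - 1) (by linarith) (γ + 1) (by linarith)
    refine ⟨hΓ, hM, ?_, ?_⟩
    · refine le_of_forall_lt fun σ' hσ' => ?_
      exact (h σ' hσ' (γ + 1) (by linarith)).2.2.1
    · by_contra hcon
      push Not at hcon
      obtain ⟨γ', hγ', hlt⟩ := EReal.lt_iff_exists_real_btwn.1 hcon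
      have := (h (σ - 1) (by linarith) γ' (EReal.coe_lt_coe_iff.1 hγ')).2.2.2
      exact lt_asymm this hlt

theorem isEdgeMinimal_iff_isOptimalSolution [Nonempty κ] [NeZero N] [NeZero n]
    {Γ : Digraph (Fin N)} {K : GainMatrix N n p} :
    IsEdgeMinimal (MeetsSpecs A C σ γ X) Γ K ↔
      ∃ PS PH, IsOptimalSolution A C σ γ X K (adjacency Γ) PS PH := by
  constructor
  · rintro ⟨hS, hmin⟩
    obtain ⟨PS, PH, hF⟩ := meetsSpecs_iff.1 hS
    refine ⟨PS, PH, hF, fun K' G' PS' PH' hF' => ?_⟩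
    obtain ⟨Γ', rfl⟩ := hF'.1.exists_digraph
    rw [trace_inDegreeMatrix_adjacency, trace_inDegreeMatrix_adjacency]
    exact_mod_cast hmin Γ' K' (meetsSpecs_iff.2 ⟨PS', PH', hF'⟩)
  · rintro ⟨PS, PH, hF, hmin⟩
    refine ⟨meetsSpecs_iff.2 ⟨PS, PH, hF⟩, fun Γ' K' hS' => ?_⟩
    obtain ⟨PS', PH', hF'⟩ := meetsSpecs_iff.1 hS'
    have := hmin K' _ PS' PH' hF'
    rw [trace_inDegreeMatrix_adjacency, trace_inDegreeMatrix_adjacency] at this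
    exact_mod_cast this

theorem LimitFeasible.isAdjacencyMatrix {K : GainMatrix N n p} {G : Matrix (Fin N) (Fin N) ℝ}
    (h : LimitFeasible A C σ γ X K G) : IsAdjacencyMatrix G := by
  obtain ⟨PS, PH, hF⟩ := h (σ - 1) (by linarith) (γ + 1) (by linarith)
  exact hF.1

theorem isEdgeMinimal_iff_isLimitOptimal [Nonempty κ] [NeZero N] [NeZero n]
    {Γ : Digraph (Fin N)} {K : GainMatrix N n p} :
    IsEdgeMinimal (MeetsSpecsNonstrict A C σ γ X) Γ K ↔
      IsLimitOptimal A C σ γ X K (adjacency Γ) := by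
  refine and_congr meetsSpecsNonstrict_iff ⟨fun hmin K' G' hF' => ?_, fun hmin Γ' K' hS' => ?_⟩
  · obtain ⟨Γ', rfl⟩ := hF'.isAdjacencyMatrix.exists_digraph
    rw [trace_inDegreeMatrix_adjacency, trace_inDegreeMatrix_adjacency]
    exact_mod_cast hmin Γ' K' (meetsSpecsNonstrict_iff.2 hF')
  · have := hmin K' _ (meetsSpecsNonstrict_iff.1 hS')
    rw [trace_inDegreeMatrix_adjacency, trace_inDegreeMatrix_adjacency] at this
    exact_mod_cast this

theorem exists_isEdgeMinimal_iff [Nonempty κ] [NeZero N] [NeZero n] :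
    (∃ (Γ : Digraph (Fin N)) (K : GainMatrix N n p), IsEdgeMinimal (MeetsSpecs A C σ γ X) Γ K) ↔
      ∃ (K : GainMatrix N n p) (G : Matrix (Fin N) (Fin N) ℝ)
        (PS PH : Matrix (Fin N × Fin n) (Fin N × Fin n) ℝ),
        IsOptimalSolution A C σ γ X K G PS PH := by
  constructor
  · rintro ⟨Γ, K, h⟩
    exact ⟨K, adjacency Γ, isEdgeMinimal_iff_isOptimalSolution.1 h⟩
  · rintro ⟨K, G, PS, PH, h⟩
    obtain ⟨Γ, rfl⟩ := h.1.1.exists_digraph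
    exact ⟨Γ, K, isEdgeMinimal_iff_isOptimalSolution.2 ⟨PS, PH, h⟩⟩

theorem minEdges_eq_optimalValue [Nonempty κ] [NeZero N] [NeZero n] :
    minEdges A C σ γ X = optimalValue A C σ γ X := by
  rw [minEdges, optimalValue]
  congr 1
  ext v
  constructor
  · rintro ⟨Γ, K, h, rfl⟩
    obtain ⟨PS, PH, hF⟩ := meetsSpecs_iff.1 h
    exact ⟨K, adjacency Γ, PS, PH, hF, by rw [trace_inDegreeMatrix_adjacency]⟩
  · rintro ⟨K, G, PS, PH, hF, rfl⟩
    obtain ⟨Γ, rfl⟩ := hF.1.exists_digraph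
    exact ⟨Γ, K, meetsSpecs_iff.2 ⟨PS, PH, hF⟩, by rw [trace_inDegreeMatrix_adjacency]⟩

end Designs

end InterconnectedObservers

theorem mainTheorem5 (N n p : ℕ) (hN : 0 < N) (hn : 0 < n)
    (A : Matrix (Fin n) (Fin n) ℝ) (C : Matrix (Fin p) (Fin n) ℝ) (σ γ : ℝ) :
    ((∀ (Γ : Digraph (Fin N)) (K : GainMatrix N n p),
      MeetsSpecs A C σ γ (matC n) Γ K ↔
        ∃ PS PH, Feasible A C σ γ (matC n) K (adjacency Γ) PS PH) ∧
    (∀ (Γ : Digraph (Fin N)) (K : GainMatrix N n p),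
      IsEdgeMinimal (MeetsSpecs A C σ γ (matC n)) Γ K ↔
        ∃ PS PH, IsOptimalSolution A C σ γ (matC n) K (adjacency Γ) PS PH) ∧
    ((∃ (Γ : Digraph (Fin N)) (K : GainMatrix N n p),
      IsEdgeMinimal (MeetsSpecs A C σ γ (matC n)) Γ K) ↔
        ∃ (K : GainMatrix N n p) (G : Matrix (Fin N) (Fin N) ℝ)
          (PS PH : Matrix (Fin N × Fin n) (Fin N × Fin n) ℝ),
          IsOptimalSolution A C σ γ (matC n) K G PS PH) ∧
    minEdges A C σ γ (matC (N := N) n) = optimalValue A C σ γ (matC (N := N) n) ∧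
    (∀ (Γ : Digraph (Fin N)) (K : GainMatrix N n p),
      MeetsSpecsNonstrict A C σ γ (matC n) Γ K ↔ LimitFeasible A C σ γ (matC n) K (adjacency Γ)) ∧
    (∀ (Γ : Digraph (Fin N)) (K : GainMatrix N n p),
      IsEdgeMinimal (MeetsSpecsNonstrict A C σ γ (matC n)) Γ K ↔
        IsLimitOptimal A C σ γ (matC n) K (adjacency Γ))) ∧
    (∀ i : Fin N,
      ((∀ (Γ : Digraph (Fin N)) (K : GainMatrix N n p),
        MeetsSpecs A C σ γ (matCLocal n i) Γ K ↔
          ∃ PS PH, Feasible A C σ γ (matCLocal n i) K (adjacency Γ) PS PH) ∧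
      (∀ (Γ : Digraph (Fin N)) (K : GainMatrix N n p),
        IsEdgeMinimal (MeetsSpecs A C σ γ (matCLocal n i)) Γ K ↔
          ∃ PS PH, IsOptimalSolution A C σ γ (matCLocal n i) K (adjacency Γ) PS PH) ∧
      ((∃ (Γ : Digraph (Fin N)) (K : GainMatrix N n p),
        IsEdgeMinimal (MeetsSpecs A C σ γ (matCLocal n i)) Γ K) ↔
          ∃ (K : GainMatrix N n p) (G : Matrix (Fin N) (Fin N) ℝ)
            (PS PH : Matrix (Fin N × Fin n) (Fin N × Fin n) ℝ),
            IsOptimalSolution A C σ γ (matCLocal n i) K G PS PH) ∧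
      minEdges A C σ γ (matCLocal n i) = optimalValue A C σ γ (matCLocal n i) ∧
      (∀ (Γ : Digraph (Fin N)) (K : GainMatrix N n p),
        MeetsSpecsNonstrict A C σ γ (matCLocal n i) Γ K ↔ LimitFeasible A C σ γ (matCLocal n i) K (adjacency Γ)) ∧
      (∀ (Γ : Digraph (Fin N)) (K : GainMatrix N n p),
        IsEdgeMinimal (MeetsSpecsNonstrict A C σ γ (matCLocal n i)) Γ K ↔
          IsLimitOptimal A C σ γ (matCLocal n i) K (adjacency Γ)))) := by
  have : NeZero N := ⟨hN.ne'⟩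
  have : NeZero n := ⟨hn.ne'⟩
  exact ⟨⟨fun _ _ => meetsSpecs_iff, fun _ _ => isEdgeMinimal_iff_isOptimalSolution,
      exists_isEdgeMinimal_iff, minEdges_eq_optimalValue, fun _ _ => meetsSpecsNonstrict_iff,
      fun _ _ => isEdgeMinimal_iff_isLimitOptimal⟩,
    fun _ => ⟨fun _ _ => meetsSpecs_iff, fun _ _ => isEdgeMinimal_iff_isOptimalSolution,
      exists_isEdgeMinimal_iff, minEdges_eq_optimalValue, fun _ _ => meetsSpecsNonstrict_iff,
      fun _ _ => isEdgeMinimal_iff_isLimitOptimal⟩⟩
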